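/- Let $d\ge 1$ be an integer. For $m\in\mathbb{N}$ let \[ f_m(x)=\frac{1}{\sqrt m}\sum_{i=1}^{m}a_i\,(w_i x+b_i)^d ,\qquad x\in\mathbb{R}, \] be the two-layer network of width $m$ with one-dimensional input and polynomial activation $\sigma(z)=z^d$, where all $a_i,w_i,b_i$ are independent $\mathcal{N}(0,1)$ random variables. Let $f:\mathbb{R}\to\mathbb{R}$ be the induced neural network Gaussian process (NNGP), that is, a random field with almost surely continuous sample paths such that, as $m\to\infty$, $f_m$ converges to $f$ in distribution (in the sense of finite-dimensional distributions). Fix a data point $\xi\in\mathbb{R}$, let $U=\mathbb{R}\times(\mathbb{R}\setminus\{0\})$, and for $(x,\lambda)\in U$ put \[ F(x,\lambda)=\begin{pmatrix} f(x)\\ x-\xi+\lambda f'(x)\end{pmatrix}, \] so that the zeros of $F$ in $U$ are the real Euclidean distance (ED) critical points of $\{f=0\}$ with respect to $\xi$. Then the number of these zeros is a random variable (up to null sets) and the expected real ED degree is \[ \mathbb{E}\Big[\#\{(x,\lambda)\in U:\ F(x,\lambda)=0\}\Big]=\frac{d}{\sqrt{2d-1}} . \] -/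

import Mathlib

open MeasureTheory ProbabilityTheory Filter
open scoped ENNReal

noncomputable section

/-- Joint law of the parameters `(a, w, b)` of one hidden neuron with a one-dimensional input:
three independent standard normal variables. -/
def neuronLaw : Measure (ℝ × ℝ × ℝ) :=
  (gaussianReal 0 1).prod ((gaussianReal 0 1).prod (gaussianReal 0 1))

instance : IsProbabilityMeasure neuronLaw := by
  unfold neuronLaw; infer_instance

/-- Law of an i.i.d. sequence `θ = (a i, w i, b i)`, `i ∈ ℕ`, of neuron parameters. The network of
width `m` uses the first `m` of them. -/
def initLaw : Measure (ℕ → ℝ × ℝ × ℝ) := Measure.infinitePi fun _ => neuronLaw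

instance : IsProbabilityMeasure initLaw := by
  unfold initLaw; infer_instance

/-- Two-layer network of width `m` with activation `σ : ℝ → ℝ` and parameters `θ`:
`f_m(x) = m^{-1/2} ∑_{i < m} a i * σ (w i * x + b i)`. -/
def twoLayerNet (σ : ℝ → ℝ) (m : ℕ) (θ : ℕ → ℝ × ℝ × ℝ) (x : ℝ) : ℝ :=
  (√(m : ℝ))⁻¹ * ∑ i ∈ Finset.range m, (θ i).1 * σ ((θ i).2.1 * x + (θ i).2.2)

/-- The random field `f : ℝ → Ω → ℝ` is the neural network Gaussian process induced by the
infinite-width two-layer network with activation `σ`: it is the limit in distribution, as the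
width tends to infinity, of the randomly initialized networks (all finite-dimensional
distributions converge weakly), and its sample paths are almost surely continuous. That the limit
is Gaussian, and which covariance kernel it has, is not part of the definition. -/
structure IsTwoLayerNNGP {Ω : Type*} [MeasurableSpace Ω] (P : Measure Ω) [IsProbabilityMeasure P]
    (σ : ℝ → ℝ) (f : ℝ → Ω → ℝ) : Prop where
  tendsto_fdd : ∀ I : Finset ℝ,
    TendstoInDistribution (fun (m : ℕ) θ (x : I) => twoLayerNet σ m θ (x : ℝ)) atTop
      (fun ω (x : I) => f (x : ℝ) ω) (fun _ => initLaw) P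
  ae_continuous : ∀ᵐ ω ∂P, Continuous fun x => f x ω

/-- The map `F(x, λ) = (g(x), x - ξ + λ g'(x))`, whose zeros are the critical points (with
multiplier `λ`) of the squared distance to `ξ` on the hypersurface `{g = 0} ⊆ ℝ`. -/
def edSystem (g : ℝ → ℝ) (ξ : ℝ) (p : ℝ × ℝ) : ℝ × ℝ :=
  (g p.1, p.1 - ξ + p.2 * deriv g p.1)

/-- The number (possibly `∞`) of real ED critical points `(x, λ) ∈ ℝ × (ℝ ∖ {0})` of `g` with
respect to the data point `ξ`. -/
def realEDCount (g : ℝ → ℝ) (ξ : ℝ) : ℝ≥0∞ :=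
  ((({p : ℝ × ℝ | p ∈ Set.univ ×ˢ ({0}ᶜ : Set ℝ) ∧ edSystem g ξ p = 0}).encard : ℕ∞) : ℝ≥0∞)

end

/-! By the central limit theorem every finite combination `∑ tᵢ f(xᵢ)` is centered Gaussian, with
variance the second moment of `∑ tᵢ (w xᵢ + b)^d` (`IsTwoLayerNNGP.map_sum_eq`). The error of
Lagrange interpolation at `d + 1` nodes vanishes on every neuron, so its variance for `f` is zero.
Hence `f` is almost surely a random polynomial `p` of degree at most `d`, all of whose linear
functionals are Gaussian.

Almost surely `p` has simple zeros and `p(ξ) ≠ 0`. Then each zero `x` carries exactly one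
multiplier, `λ = (ξ - x) / p'(x) ≠ 0`, and it remains to count real zeros of `p`.

The function `g(x) = p(x) / (1 + x²)^(d/2)` has the same zeros. Write `M_k` for the moment of order
`2k` of a standard normal variable. Rotation invariance of `(w, b)` shows that `g(x)` has constant
variance `M_d` and that `g'(x)` is independent of `g(x)`, with variance `d² M_{d-1} / (1 + x²)²`.
Kac–Rice then gives `(2π M_d)^(-1/2) · √(2/π) · d √M_{d-1} · ∫ dx / (1 + x²) = d √(M_{d-1} / M_d) =
d / √(2d - 1)`. Kac–Rice itself is the limit `ε → 0` of `(2ε)⁻¹ ∫_{|g| < ε} |g'|` (`zeroApprox`),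
which is eventually equal to the number of zeros and is at most `d + 2`, so dominated convergence
applies. -/

open scoped Polynomial Topology NNReal

noncomputable section

/-! ### Gaussianity of the limit field. -/

/-- The joint law of the inner parameters `(w, b)` of a neuron. -/
def innerLaw : Measure (ℝ × ℝ) := (gaussianReal 0 1).prod (gaussianReal 0 1)

instance : IsProbabilityMeasure innerLaw := by
  unfold innerLaw; infer_instance

lemma neuronLaw_eq : neuronLaw = (gaussianReal 0 1).prod innerLaw := rfl

lemma integrable_pow_gaussianReal (m : ℝ) (v : ℝ≥0) (n : ℕ) :
    Integrable (fun x : ℝ => x ^ n) (gaussianReal m v) := by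
  have h := (memLp_id_gaussianReal (μ := m) (v := v) n).integrable_norm_pow'
  refine h.mono (by fun_prop) (.of_forall fun x => ?_)
  simp

lemma isGaussian_innerLaw : IsGaussian innerLaw := by
  have h1 : innerLaw.map (fun p : ℝ × ℝ => p.1) = gaussianReal 0 1 :=
    (measurePreserving_fst (μ := gaussianReal 0 1) (ν := gaussianReal 0 1)).map_eq
  have h2 : innerLaw.map (fun p : ℝ × ℝ => p.2) = gaussianReal 0 1 :=
    (measurePreserving_snd (μ := gaussianReal 0 1) (ν := gaussianReal 0 1)).map_eq
  have h := (indepFun_prod (μ := gaussianReal 0 1) (ν := gaussianReal 0 1)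
    (X := fun x : ℝ => x) (Y := fun x : ℝ => x) measurable_id measurable_id).hasGaussianLaw
    ⟨by change IsGaussian (innerLaw.map fun p => p.1); rw [h1]; infer_instance⟩
    ⟨by change IsGaussian (innerLaw.map fun p => p.2); rw [h2]; infer_instance⟩
  simpa [innerLaw] using h.isGaussian_map

lemma integrable_linear_pow (x y : ℝ) (n : ℕ) :
    Integrable (fun z : ℝ × ℝ => (z.1 * x + z.2 * y) ^ n) innerLaw := by
  have := isGaussian_innerLaw
  have h := IsGaussian.memLp_dual innerLaw
    (x • ContinuousLinearMap.fst ℝ ℝ ℝ + y • ContinuousLinearMap.snd ℝ ℝ ℝ) n (by simp)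
  refine h.integrable_norm_pow'.mono (by fun_prop) (.of_forall fun z => ?_)
  simp [mul_comm]

lemma memLp_linear_pow (x y : ℝ) (n : ℕ) :
    MemLp (fun z : ℝ × ℝ => (z.1 * x + z.2 * y) ^ n) 2 innerLaw := by
  rw [memLp_two_iff_integrable_sq (by fun_prop)]
  simpa only [← pow_mul] using integrable_linear_pow x y (n * 2)

section

variable {Ω : Type*} [MeasurableSpace Ω] {P : Measure Ω} [IsProbabilityMeasure P]

/-- Finite linear combinations of the values of the NNGP are centered Gaussian, and their variance
is the second moment of the same combination of a single neuron. -/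
theorem IsTwoLayerNNGP.map_sum_eq {d : ℕ} {f : ℝ → Ω → ℝ}
    (hf : IsTwoLayerNNGP P (fun z => z ^ d) f) {ι : Type*} [Fintype ι] (x t : ι → ℝ) :
    P.map (fun ω => ∑ i, t i * f (x i) ω) = gaussianReal 0
      (∫ z, (∑ i, t i * (z.1 * x i + z.2) ^ d) ^ 2 ∂innerLaw).toNNReal := by
  classical
  set S : ℝ × ℝ → ℝ := fun z => ∑ i, t i * (z.1 * x i + z.2) ^ d with hS
  have hSm : Measurable S := by fun_prop
  have hSL : MemLp S 2 innerLaw := by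
    refine memLp_finsetSum _ fun i _ => ?_
    simpa using (memLp_linear_pow (x i) 1 d).const_mul (t i)
  have hSi : Integrable (fun z => S z ^ 2) innerLaw := hSL.integrable_sq
  let Y : ℝ × ℝ × ℝ → ℝ := fun θ => θ.1 * S θ.2
  have hYm : Measurable Y := by fun_prop
  have hY2 : Integrable (fun θ => Y θ ^ 2) neuronLaw := by
    have := (integrable_pow_gaussianReal 0 1 2).mul_prod hSi
    simpa only [Y, mul_pow, neuronLaw_eq] using this
  have hYL : MemLp Y 2 neuronLaw := (memLp_two_iff_integrable_sq (by fun_prop)).2 hY2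
  -- The outer weight is centered and independent of `(w, b)`, so no centering of `S` is needed.
  have hY0 : ∫ θ, Y θ ∂neuronLaw = 0 := by
    rw [neuronLaw_eq]
    simp only [Y]
    rw [integral_prod_mul (fun a : ℝ => a) S]
    simp
  have hYV : Var[Y; neuronLaw] = ∫ z, S z ^ 2 ∂innerLaw := by
    rw [variance_of_integral_eq_zero hYm.aemeasurable hY0, neuronLaw_eq]
    simp only [Y, mul_pow]
    rw [integral_prod_mul (fun a : ℝ => a ^ 2) (fun z => S z ^ 2)]
    have := variance_of_integral_eq_zero (μ := gaussianReal 0 1) (X := fun x : ℝ => x)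
      (by fun_prop) (by simp)
    rw [← this]; simp
  have hlaw (k : ℕ) : initLaw.map (fun θ => θ k) = neuronLaw := by
    rw [initLaw]; exact Measure.infinitePi_map_eval _ k
  have hident (k : ℕ) : IdentDistrib (fun θ : ℕ → ℝ × ℝ × ℝ => Y (θ k)) (fun θ => Y (θ 0))
      initLaw initLaw := by
    refine IdentDistrib.comp (u := Y) ⟨(measurable_pi_apply k).aemeasurable,
      (measurable_pi_apply 0).aemeasurable, ?_⟩ hYm
    rw [hlaw, hlaw]
  have hid0 : IdentDistrib (fun θ : ℕ → ℝ × ℝ × ℝ => Y (θ 0)) Y initLaw neuronLaw :=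
    IdentDistrib.comp (u := Y) (g := id) ⟨(measurable_pi_apply 0).aemeasurable, by fun_prop,
      by rw [hlaw, Measure.map_id]⟩
      hYm
  have hindep : iIndepFun (fun (k : ℕ) (θ : ℕ → ℝ × ℝ × ℝ) => Y (θ k)) initLaw :=
    iIndepFun_infinitePi (X := fun _ => Y) (fun _ => hYm)
  have hclt := tendstoInDistribution_inv_sqrt_mul_sum_sub
    (P' := gaussianReal 0 (∫ z, S z ^ 2 ∂innerLaw).toNNReal) (Y := id)
    (P := initLaw) (X := fun (k : ℕ) θ => Y (θ k))
    (by rw [hid0.variance_eq, hYV]; exact HasLaw.id) (hid0.memLp_iff.2 hYL) hindep hident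
  rw [hid0.integral_eq, hY0] at hclt
  -- The same normalized sums also converge to `∑ tᵢ f(xᵢ)`, and weak limits are unique. Taking the
  -- image of `x` as index set allows repeated points.
  have hlim := (hf.tendsto_fdd (Finset.univ.image x)).continuous_comp
    (g := fun y => ∑ i, t i * y ⟨x i, by simp⟩)
    (continuous_finsetSum _ fun i _ => continuous_const.mul (continuous_apply _))
  have heq : (fun (m : ℕ) => (fun y : (Finset.univ.image x) → ℝ => ∑ i, t i * y ⟨x i, by simp⟩) ∘
      fun θ (x : Finset.univ.image x) => twoLayerNet (fun z => z ^ d) m θ (x : ℝ)) =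
      fun (m : ℕ) θ => (√(m : ℝ))⁻¹ * (∑ k ∈ Finset.range m, Y (θ k) - m * 0) := by
    funext m θ
    simp only [Function.comp, twoLayerNet, Y, hS, mul_zero, sub_zero, Finset.mul_sum]
    rw [Finset.sum_comm]
    refine Finset.sum_congr rfl fun k _ => Finset.sum_congr rfl fun i _ => by ring
  rw [heq] at hlim
  have := tendstoInDistribution_unique _ hlim hclt
  simpa [Function.comp_def] using this

lemma IsTwoLayerNNGP.aemeasurable {σ : ℝ → ℝ} {f : ℝ → Ω → ℝ} (hf : IsTwoLayerNNGP P σ f)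
    (x : ℝ) : AEMeasurable (f x) P := by
  have h := (hf.tendsto_fdd {x}).aemeasurable_limit
  exact (measurable_pi_apply (⟨x, by simp⟩ : ({x} : Finset ℝ))).comp_aemeasurable h

end

/-! ### The limit field is a random polynomial. -/

section

variable {Ω : Type*} [MeasurableSpace Ω] {P : Measure Ω} [IsProbabilityMeasure P]

/-- The polynomial `(w X + b) ^ d` computed by a neuron with inner parameters `z = (w, b)`. -/
def neuronPoly (d : ℕ) (z : ℝ × ℝ) : ℝ[X] :=
  (Polynomial.C z.1 * Polynomial.X + Polynomial.C z.2) ^ d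

lemma eval_neuronPoly (d : ℕ) (z : ℝ × ℝ) (x : ℝ) :
    (neuronPoly d z).eval x = (z.1 * x + z.2) ^ d := by
  simp [neuronPoly]

lemma natDegree_neuronPoly_le (d : ℕ) (z : ℝ × ℝ) : (neuronPoly d z).natDegree ≤ d := by
  unfold neuronPoly
  compute_degree

/-- The second moment of a linear functional evaluated at the polynomial of a random neuron. -/
def secondMoment (d : ℕ) (l : ℝ[X] →ₗ[ℝ] ℝ) : ℝ := ∫ z, l (neuronPoly d z) ^ 2 ∂innerLaw

/-- A random polynomial of degree at most `d` all of whose linear functionals are centered Gaussian,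
with the covariance structure of the polynomial of a random neuron. -/
structure IsNeuronGaussianPoly (d : ℕ) (P : Measure Ω) (p : Ω → ℝ[X]) : Prop where
  natDegree_le : ∀ ω, (p ω).natDegree ≤ d
  measurable : ∀ l : ℝ[X] →ₗ[ℝ] ℝ, Measurable fun ω => l (p ω)
  map_eq : ∀ l : ℝ[X] →ₗ[ℝ] ℝ,
    P.map (fun ω => l (p ω)) = gaussianReal 0 (secondMoment d l).toNNReal

/-- Interpolation at the nodes `0, …, d` is exact in degree at most `d`. This reduces any linear
functional to point values, which `map_sum_eq` controls. -/
lemma linearMap_eq_sum_basis {d : ℕ} {q : ℝ[X]} (hq : q.natDegree ≤ d) (l : ℝ[X] →ₗ[ℝ] ℝ) :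
    l q = ∑ i : Fin (d + 1),
      l (Lagrange.basis Finset.univ (fun i : Fin (d + 1) => (i : ℝ)) i) * q.eval (i : ℝ) := by
  have hinj : Set.InjOn (fun i : Fin (d + 1) => (i : ℝ)) (Finset.univ : Finset (Fin (d + 1))) := by
    intro i _ j _ h
    simpa [Fin.val_inj] using h
  have hdeg : q.degree < (Finset.univ : Finset (Fin (d + 1))).card := by
    rw [Finset.card_univ, Fintype.card_fin]
    exact Polynomial.degree_le_natDegree.trans_lt (by exact_mod_cast Nat.lt_succ_of_le hq)
  conv_lhs => rw [Lagrange.eq_interpolate hinj hdeg]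
  rw [Lagrange.interpolate_apply, map_sum]
  refine Finset.sum_congr rfl fun i _ => ?_
  rw [← Polynomial.smul_eq_C_mul, map_smul, smul_eq_mul, mul_comm]

theorem IsTwoLayerNNGP.exists_isNeuronGaussianPoly {d : ℕ} {f : ℝ → Ω → ℝ}
    (hf : IsTwoLayerNNGP P (fun z => z ^ d) f) :
    ∃ p : Ω → ℝ[X], IsNeuronGaussianPoly d P p ∧ ∀ᵐ ω ∂P, ∀ x, f x ω = (p ω).eval x := by
  set v : Fin (d + 1) → ℝ := fun i => (i : ℝ) with hv
  have hinj : Set.InjOn v (Finset.univ : Finset (Fin (d + 1))) := by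
    intro i _ j _ h
    simpa [v, Fin.val_inj] using h
  -- The values of `f` are only almost everywhere measurable; interpolating measurable modifications
  -- makes `p` measurable everywhere.
  set y : Fin (d + 1) → Ω → ℝ := fun i => (hf.aemeasurable (v i)).mk (f (v i)) with hy
  have hym (i) : Measurable (y i) := (hf.aemeasurable (v i)).measurable_mk
  have hyf : ∀ᵐ ω ∂P, ∀ i, f (v i) ω = y i ω :=
    ae_all_iff.2 fun i => (hf.aemeasurable (v i)).ae_eq_mk
  set p : Ω → ℝ[X] := fun ω => Lagrange.interpolate Finset.univ v fun i => y i ω with hp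
  have hpdeg (ω) : (p ω).natDegree ≤ d := by
    have := Lagrange.degree_interpolate_le (fun i => y i ω) hinj
    exact Polynomial.natDegree_le_of_degree_le (by
      simpa only [Finset.card_univ, Fintype.card_fin, Nat.add_sub_cancel] using this)
  have hpl (l : ℝ[X] →ₗ[ℝ] ℝ) (ω) :
      l (p ω) = ∑ i, l (Lagrange.basis Finset.univ v i) * y i ω := by
    rw [linearMap_eq_sum_basis (hpdeg ω) l]
    refine Finset.sum_congr rfl fun i _ => ?_
    rw [show ((i : ℕ) : ℝ) = v i from rfl,
      Lagrange.eval_interpolate_at_node _ hinj (Finset.mem_univ i)]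
  refine ⟨p, ⟨hpdeg, fun l => ?_, fun l => ?_⟩, ?_⟩
  · simp only [hpl]
    exact Finset.measurable_fun_sum _ fun i _ => (hym i).const_mul _
  · have h := hf.map_sum_eq v fun i => l (Lagrange.basis Finset.univ v i)
    have h1 : P.map (fun ω => l (p ω)) =
        P.map (fun ω => ∑ i, l (Lagrange.basis Finset.univ v i) * f (v i) ω) := by
      refine Measure.map_congr ?_
      filter_upwards [hyf] with ω hω
      simp only [hpl, hω]
    rw [h1, h, secondMoment]
    congr 3 with z
    rw [linearMap_eq_sum_basis (natDegree_neuronPoly_le d z) l]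
    simp only [eval_neuronPoly, hv]
  · have hx (x : ℝ) : ∀ᵐ ω ∂P, f x ω = (p ω).eval x := by
      -- `none` stands for the point `x`, `some i` for the nodes: the combination is the
      -- interpolation error at `x`, of variance zero.
      have h := hf.map_sum_eq (ι := Option (Fin (d + 1))) (fun o => o.elim x v)
        (fun o => o.elim 1 fun i => -(Lagrange.basis Finset.univ v i).eval x)
      have h0 (z : ℝ × ℝ) : ∑ o : Option (Fin (d + 1)),
          o.elim 1 (fun i => -(Lagrange.basis Finset.univ v i).eval x) *
            (z.1 * o.elim x v + z.2) ^ d = 0 := by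
        have := linearMap_eq_sum_basis (natDegree_neuronPoly_le d z) (Polynomial.leval x)
        simp only [Polynomial.leval_apply, eval_neuronPoly] at this
        simp [Fintype.sum_option, this, v]
      simp only [h0] at h
      simp only [ne_eq, OfNat.ofNat_ne_zero, not_false_eq_true, zero_pow, integral_zero,
        Real.toNNReal_zero, gaussianReal_zero_var] at h
      have hm : AEMeasurable (fun ω => ∑ o : Option (Fin (d + 1)),
          o.elim 1 (fun i => -(Lagrange.basis Finset.univ v i).eval x) *
            f (o.elim x v) ω) P :=
        Finset.aemeasurable_fun_sum _ fun o _ => (hf.aemeasurable _).const_mul _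
      have h2 : ∀ᵐ s ∂(Measure.dirac (0 : ℝ)), s = 0 := by simp
      rw [← h] at h2
      filter_upwards [ae_of_ae_map hm h2, hyf] with ω hω hyω
      have h3 := hpl (Polynomial.leval x) ω
      simp only [Polynomial.leval_apply] at h3
      rw [h3]
      simp only [Fintype.sum_option, Option.elim, one_mul, neg_mul, Finset.sum_neg_distrib] at hω
      rw [← sub_eq_add_neg, sub_eq_zero] at hω
      rw [hω]
      exact Finset.sum_congr rfl fun i _ => by rw [hyω]
    -- The exceptional null set depends on `x`. Restricting to rationals gives a single null set,
    -- and continuity extends the equality to all reals.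
    have hq : ∀ᵐ ω ∂P, ∀ q : ℚ, f q ω = (p ω).eval (q : ℝ) := ae_all_iff.2 fun q => hx q
    filter_upwards [hq, hf.ae_continuous] with ω hω hc
    have := Rat.denseRange_cast (𝕜 := ℝ) |>.equalizer hc (p ω).continuous (funext hω)
    exact congrFun this

end

/-! ### Moments of the normal distribution. -/

lemma gaussianPDFReal_zero (v : ℝ≥0) (x : ℝ) :
    gaussianPDFReal 0 v x = (√(2 * Real.pi * v))⁻¹ * Real.exp (-x ^ 2 / (2 * v)) := by
  simp [gaussianPDFReal]

lemma gaussianPDFReal_one_eq : gaussianPDFReal 0 1 = fun x =>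
    (√(2 * Real.pi))⁻¹ * Real.exp (-x ^ 2 / 2) := by
  funext x
  simp [gaussianPDFReal_zero]

lemma hasDerivAt_gaussianPDFReal (x : ℝ) :
    HasDerivAt (gaussianPDFReal 0 1) (-(x * gaussianPDFReal 0 1 x)) x := by
  rw [gaussianPDFReal_one_eq]
  have h : HasDerivAt (fun x : ℝ => -x ^ 2 / 2) (-x) x := by
    have := ((hasDerivAt_pow 2 x).neg).div_const 2
    refine this.congr_deriv ?_
    simp only [Nat.cast_ofNat, Nat.add_one_sub_one, pow_one]
    ring
  refine (h.exp.const_mul _).congr_deriv ?_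
  ring

lemma integrable_pow_mul_gaussianPDFReal (n : ℕ) :
    Integrable fun x : ℝ => x ^ n * gaussianPDFReal 0 1 x := by
  have h := integrable_pow_gaussianReal 0 1 n
  rw [gaussianReal_of_var_ne_zero _ one_ne_zero, gaussianPDF_def,
    integrable_withDensity_iff (by fun_prop) (.of_forall fun _ => ENNReal.ofReal_lt_top)] at h
  simpa [ENNReal.toReal_ofReal, gaussianPDFReal_nonneg] using h

/-- Integration by parts with `φ' = -x φ` for the standard normal density `φ`. -/
lemma integral_pow_add_two_gaussianReal (n : ℕ) :
    ∫ x, x ^ (n + 2) ∂gaussianReal 0 1 = (n + 1) * ∫ x, x ^ n ∂gaussianReal 0 1 := by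
  rw [integral_gaussianReal_eq_integral_smul one_ne_zero,
    integral_gaussianReal_eq_integral_smul one_ne_zero]
  have h := integral_mul_deriv_eq_deriv_mul_of_integrable (u := fun x : ℝ => x ^ (n + 1))
    (u' := fun x => (n + 1 : ℝ) * x ^ n) (v := gaussianPDFReal 0 1)
    (v' := fun x => -(x * gaussianPDFReal 0 1 x))
    (fun x _ => by simpa using hasDerivAt_pow (n + 1) x)
    (fun x _ => hasDerivAt_gaussianPDFReal x) ?_ ?_ (integrable_pow_mul_gaussianPDFReal _)
  · rw [← integral_const_mul]
    simp only [smul_eq_mul]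
    have h1 : ∀ x : ℝ, gaussianPDFReal 0 1 x * x ^ (n + 2) =
        -(x ^ (n + 1) * -(x * gaussianPDFReal 0 1 x)) := fun x => by ring
    simp only [h1, integral_neg, h, neg_neg]
    exact integral_congr_ae (.of_forall fun x => by ring)
  · refine (integrable_pow_mul_gaussianPDFReal (n + 2)).neg.congr (.of_forall fun x => ?_)
    simp only [Pi.neg_apply, Pi.mul_apply]
    ring
  · refine ((integrable_pow_mul_gaussianPDFReal n).const_mul (n + 1)).congr (.of_forall fun x => ?_)
    simp only [Pi.mul_apply]
    ring

lemma tendsto_gaussianPDFReal_atTop : Tendsto (gaussianPDFReal 0 1) atTop (𝓝 0) := by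
  rw [gaussianPDFReal_one_eq]
  have h : Tendsto (fun x : ℝ => -x ^ 2 / 2) atTop atBot := by
    have := (tendsto_pow_atTop (α := ℝ) two_ne_zero).atTop_div_const (r := 2) (by norm_num)
    refine (tendsto_neg_atTop_atBot.comp this).congr fun x => ?_
    simp [neg_div]
  simpa using (Real.tendsto_exp_atBot.comp h).const_mul (√(2 * Real.pi))⁻¹

lemma integral_abs_gaussianReal : ∫ x, |x| ∂gaussianReal 0 1 = √(2 / Real.pi) := by
  rw [integral_gaussianReal_eq_integral_smul one_ne_zero]
  have h1 : (fun x : ℝ => gaussianPDFReal 0 1 x • |x|) =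
      fun x => (fun y => y * gaussianPDFReal 0 1 y) |x| := by
    funext x
    simp [gaussianPDFReal_one_eq, mul_comm]
  rw [h1, integral_comp_abs (f := fun y => y * gaussianPDFReal 0 1 y)]
  have h2 := integral_Ioi_of_hasDerivAt_of_tendsto' (a := 0)
    (f := fun x => -gaussianPDFReal 0 1 x) (f' := fun y => y * gaussianPDFReal 0 1 y) (m := 0)
    (fun x _ => (hasDerivAt_gaussianPDFReal x).neg.congr_deriv (neg_neg _))
    (by simpa using (integrable_pow_mul_gaussianPDFReal 1).integrableOn)
    (by simpa using tendsto_gaussianPDFReal_atTop.neg)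
  rw [h2, gaussianPDFReal_one_eq]
  have h3 : √(2 / Real.pi) = 2 / √(2 * Real.pi) := by
    rw [show (2 : ℝ) / Real.pi = 2 ^ 2 / (2 * Real.pi) by field_simp,
      Real.sqrt_div (by norm_num), Real.sqrt_sq (by norm_num)]
  rw [h3]
  simp [div_eq_mul_inv]

lemma lintegral_enorm_gaussianReal (v : ℝ≥0) :
    ∫⁻ x, ‖x‖ₑ ∂gaussianReal 0 v = ENNReal.ofReal (√v * √(2 / Real.pi)) := by
  have h1 : gaussianReal 0 v = (gaussianReal 0 1).map (√(v : ℝ) * ·) := by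
    rw [gaussianReal_map_const_mul]
    congr 1
    · simp
    · ext; simp
  have hi : Integrable (fun x : ℝ => x) (gaussianReal 0 1) := by
    simpa using integrable_pow_gaussianReal 0 1 1
  rw [h1, lintegral_map (by fun_prop) (by fun_prop)]
  simp only [enorm_mul]
  rw [lintegral_const_mul _ (by fun_prop), ← ofReal_integral_norm_eq_lintegral_enorm hi]
  simp only [Real.norm_eq_abs, integral_abs_gaussianReal]
  rw [Real.enorm_eq_ofReal (Real.sqrt_nonneg _), ENNReal.ofReal_mul (Real.sqrt_nonneg _)]

/-- The even moments of the standard normal distribution. -/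
def gaussianMoment (n : ℕ) : ℝ := ∫ x, x ^ (2 * n) ∂gaussianReal 0 1

lemma gaussianMoment_succ (n : ℕ) :
    gaussianMoment (n + 1) = (2 * n + 1) * gaussianMoment n := by
  have := integral_pow_add_two_gaussianReal (2 * n)
  push_cast at this
  exact this

lemma gaussianMoment_pos (n : ℕ) : 0 < gaussianMoment n := by
  induction n with
  | zero => simp [gaussianMoment]
  | succ n ih => rw [gaussianMoment_succ]; positivity

/-! ### The normalized polynomial and its derivative at a point. -/

/-- The Gaussian law of `(w, b)` is invariant under the reflection sending `(w, b)` to the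
coordinates along and across the direction `(x, 1)`. -/
lemma map_rotation_innerLaw (x : ℝ) :
    innerLaw.map (fun z => ((z.1 * x + z.2) / √(1 + x ^ 2), (z.1 - z.2 * x) / √(1 + x ^ 2))) =
      innerLaw := by
  set s := √(1 + x ^ 2) with hs
  have hs0 : 0 < s := Real.sqrt_pos.2 (by positivity)
  have hs2 : s ^ 2 = 1 + x ^ 2 := Real.sq_sqrt (by positivity)
  let R : ℝ × ℝ →L[ℝ] ℝ × ℝ :=
    ((x / s) • ContinuousLinearMap.fst ℝ ℝ ℝ + s⁻¹ • ContinuousLinearMap.snd ℝ ℝ ℝ).prod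
      (s⁻¹ • ContinuousLinearMap.fst ℝ ℝ ℝ - (x / s) • ContinuousLinearMap.snd ℝ ℝ ℝ)
  have hR : (fun z : ℝ × ℝ => ((z.1 * x + z.2) / s, (z.1 - z.2 * x) / s)) = R := by
    funext z
    simp only [R, ContinuousLinearMap.prod_apply, _root_.add_apply,
      _root_.sub_apply, _root_.smul_apply, ContinuousLinearMap.coe_fst',
      ContinuousLinearMap.coe_snd', smul_eq_mul, Prod.mk.injEq]
    constructor <;> field_simp
  -- The characteristic function depends only on the Euclidean norm of `L`, which the orthogonal map
  -- `R` preserves.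
  have hchar (L : StrongDual ℝ (ℝ × ℝ)) : charFunDual innerLaw L =
      Complex.exp ((-((L (1, 0)) ^ 2 + (L (0, 1)) ^ 2) / 2 : ℝ)) := by
    rw [innerLaw, charFunDual_prod, charFunDual_eq_charFun_map_one, charFunDual_eq_charFun_map_one,
      gaussianReal_map_continuousLinearMap, gaussianReal_map_continuousLinearMap,
      charFun_gaussianReal, charFun_gaussianReal, ← Complex.exp_add]
    congr 1
    have h0 : L (0, 0) = 0 := L.map_zero
    simp [h0, max_eq_left (sq_nonneg _)]
    ring
  have : IsProbabilityMeasure (innerLaw.map R) :=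
    Measure.isProbabilityMeasure_map R.continuous.aemeasurable
  rw [hR]
  refine Measure.ext_of_charFunDual ?_
  ext L
  rw [charFunDual_map, hchar, hchar]
  congr 2
  have hL (a b : ℝ) : L (a, b) = a * L (1, 0) + b * L (0, 1) := by
    rw [show ((a, b) : ℝ × ℝ) = a • (1, 0) + b • (0, 1) by simp, map_add, map_smul, map_smul]
    simp
  simp only [ContinuousLinearMap.comp_apply, R, ContinuousLinearMap.prod_apply,
    _root_.add_apply,
      _root_.sub_apply, _root_.smul_apply, ContinuousLinearMap.coe_fst',
      ContinuousLinearMap.coe_snd', smul_eq_mul]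
  rw [hL (_ + _), hL (x / s * 0 + _)]
  have : s⁻¹ ^ 2 * (1 + x ^ 2) = 1 := by rw [← hs2]; field_simp
  simp only [div_eq_mul_inv]
  linear_combination (-(L (1, 0) ^ 2 + L (0, 1) ^ 2) / 2) * this

/-- The value at `x` of the polynomial `p`, normalized by `(1 + x²) ^ (d / 2)`. -/
def sphereEval (d : ℕ) (x : ℝ) : ℝ[X] →ₗ[ℝ] ℝ := (√(1 + x ^ 2) ^ d)⁻¹ • Polynomial.leval x

/-- The derivative at `x` of `fun x => sphereEval d x p`. -/
def sphereDeriv (d : ℕ) (x : ℝ) : ℝ[X] →ₗ[ℝ] ℝ :=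
  (√(1 + x ^ 2) ^ (d + 2))⁻¹ • ((1 + x ^ 2) • (Polynomial.leval x ∘ₗ Polynomial.derivative) -
    (d * x) • Polynomial.leval x)

lemma sphereEval_apply (d : ℕ) (x : ℝ) (p : ℝ[X]) :
    sphereEval d x p = (√(1 + x ^ 2) ^ d)⁻¹ * p.eval x := rfl

lemma sphereDeriv_apply (d : ℕ) (x : ℝ) (p : ℝ[X]) :
    sphereDeriv d x p = (√(1 + x ^ 2) ^ (d + 2))⁻¹ *
      ((1 + x ^ 2) * (Polynomial.derivative p).eval x - d * x * p.eval x) := rfl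

lemma hasDerivAt_sphereEval (d : ℕ) (x : ℝ) (p : ℝ[X]) :
    HasDerivAt (fun x => sphereEval d x p) (sphereDeriv d x p) x := by
  have hs0 : 0 < √(1 + x ^ 2) := Real.sqrt_pos.2 (by positivity)
  have hs2 : √(1 + x ^ 2) ^ 2 = 1 + x ^ 2 := Real.sq_sqrt (by positivity)
  have h1 : HasDerivAt (fun x : ℝ => 1 + x ^ 2) (2 * x) x := by
    simpa using (hasDerivAt_pow 2 x).const_add 1
  have h2 := (h1.sqrt (by positivity)).pow d
  have h3 := (h2.inv (pow_pos hs0 d).ne').mul (p.hasDerivAt x)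
  refine h3.congr_deriv ?_
  rw [sphereDeriv_apply]
  simp only [Pi.inv_apply, Pi.pow_apply]
  set s := √(1 + x ^ 2)
  rw [← hs2]
  rcases d with _ | d
  · simp; field_simp
  · simp only [Nat.add_sub_cancel]
    field_simp
    ring

lemma sphereEval_neuronPoly (d : ℕ) (x : ℝ) (z : ℝ × ℝ) :
    sphereEval d x (neuronPoly d z) = ((z.1 * x + z.2) / √(1 + x ^ 2)) ^ d := by
  rw [sphereEval_apply, eval_neuronPoly, div_pow]
  ring

/-- For the rotated coordinates `u = (w x + b) / √(1 + x²)` and `v = (w - b x) / √(1 + x²)` one has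
`du/dx = v / (1 + x²)`; this is the chain rule for `u^d`. -/
lemma sphereDeriv_neuronPoly {d : ℕ} (hd : 1 ≤ d) (x : ℝ) (z : ℝ × ℝ) :
    sphereDeriv d x (neuronPoly d z) = d / (1 + x ^ 2) *
      (((z.1 * x + z.2) / √(1 + x ^ 2)) ^ (d - 1) * ((z.1 - z.2 * x) / √(1 + x ^ 2))) := by
  obtain ⟨n, rfl⟩ : ∃ n, d = n + 1 := ⟨d - 1, by omega⟩
  have hs0 : 0 < √(1 + x ^ 2) := Real.sqrt_pos.2 (by positivity)
  have hs2 : √(1 + x ^ 2) ^ 2 = 1 + x ^ 2 := Real.sq_sqrt (by positivity)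
  rw [sphereDeriv_apply, eval_neuronPoly, neuronPoly]
  simp only [Polynomial.derivative_pow, Polynomial.eval_mul, Polynomial.eval_pow,
    Polynomial.eval_add, Polynomial.eval_C, Polynomial.eval_X, Polynomial.derivative_add,
    Polynomial.derivative_mul, Polynomial.derivative_C, Polynomial.derivative_X, Nat.add_sub_cancel,
    Polynomial.eval_zero, Polynomial.eval_one, map_natCast, Polynomial.eval_natCast]
  set s := √(1 + x ^ 2)
  rw [← hs2, div_pow]
  push_cast
  field_simp
  rw [hs2]
  ring

/-- In the rotated coordinates the cross term is odd in the second variable and integrates to zero.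
Having all `α`, `β` at once determines the joint Gaussian law. -/
lemma secondMoment_sphere {d : ℕ} (hd : 1 ≤ d) (x α β : ℝ) :
    secondMoment d (α • sphereEval d x + β • sphereDeriv d x) =
      α ^ 2 * gaussianMoment d + β ^ 2 * (d ^ 2 * gaussianMoment (d - 1) / (1 + x ^ 2) ^ 2) := by
  have h0 : secondMoment d (α • sphereEval d x + β • sphereDeriv d x) =
      ∫ z, (α * z.1 ^ d + β * (d / (1 + x ^ 2) * (z.1 ^ (d - 1) * z.2))) ^ 2 ∂innerLaw := by
    conv_rhs => rw [← map_rotation_innerLaw x]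
    rw [integral_map (by fun_prop) (by fun_prop)]
    simp only [secondMoment, LinearMap.add_apply, LinearMap.smul_apply, sphereEval_neuronPoly,
      sphereDeriv_neuronPoly hd, smul_eq_mul]
  have hi (n m : ℕ) : Integrable (fun z : ℝ × ℝ => z.1 ^ n * z.2 ^ m) innerLaw :=
    (integrable_pow_gaussianReal 0 1 n).mul_prod (integrable_pow_gaussianReal 0 1 m)
  have hI (n m : ℕ) : ∫ z : ℝ × ℝ, z.1 ^ n * z.2 ^ m ∂innerLaw =
      (∫ x, x ^ n ∂gaussianReal 0 1) * ∫ x, x ^ m ∂gaussianReal 0 1 :=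
    integral_prod_mul (fun x : ℝ => x ^ n) (fun x : ℝ => x ^ m)
  have h2 : ∀ z : ℝ × ℝ, (α * z.1 ^ d + β * (d / (1 + x ^ 2) * (z.1 ^ (d - 1) * z.2))) ^ 2 =
      α ^ 2 * (z.1 ^ (2 * d) * z.2 ^ 0) +
      (2 * α * β * (d / (1 + x ^ 2))) * (z.1 ^ (d + (d - 1)) * z.2 ^ 1) +
      β ^ 2 * (d / (1 + x ^ 2)) ^ 2 * (z.1 ^ (2 * (d - 1)) * z.2 ^ 2) := fun z => by ring
  rw [h0]
  simp only [h2]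
  rw [integral_add (((hi _ _).const_mul _).fun_add ((hi _ _).const_mul _)) ((hi _ _).const_mul _),
    integral_add ((hi _ _).const_mul _) ((hi _ _).const_mul _), integral_const_mul,
    integral_const_mul, integral_const_mul, hI, hI, hI]
  have e2 : ∫ x, x ^ 2 ∂gaussianReal 0 1 = 1 := by
    simpa using integral_pow_add_two_gaussianReal 0
  have e1 : ∫ x, x ^ 1 ∂gaussianReal 0 1 = 0 := by simp
  rw [e1, e2]
  simp only [pow_zero, integral_const, probReal_univ, smul_eq_mul, mul_one, mul_zero, add_zero,
    gaussianMoment, div_pow]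
  ring

/-! ### Kac's counting formula for a function with finitely many critical points. -/

/-- The points outside the finite set `C` with exactly `k` points of `C` to their left. -/
def gapPiece (C : Finset ℝ) (k : ℕ) : Set ℝ := {x | x ∉ C ∧ (C.filter (· < x)).card = k}

/-- The count is monotone in the point, so equal counts at two points leave no element of `C`
between them. -/
lemma ordConnected_gapPiece (C : Finset ℝ) (k : ℕ) : (gapPiece C k).OrdConnected := by
  refine ⟨fun x hx y hy z hz => ?_⟩
  have h1 : C.filter (· < x) ⊆ C.filter (· < z) := fun c hc => by
    simp only [Finset.mem_filter] at hc ⊢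
    exact ⟨hc.1, hc.2.trans_le hz.1⟩
  have h2 : C.filter (· < z) ⊆ C.filter (· < y) := fun c hc => by
    simp only [Finset.mem_filter] at hc ⊢
    exact ⟨hc.1, hc.2.trans_le hz.2⟩
  have h3 : C.filter (· < x) = C.filter (· < y) :=
    Finset.eq_of_subset_of_card_le (h1.trans h2) (by rw [hx.2, hy.2])
  refine ⟨fun hzC => ?_, le_antisymm ?_ ?_⟩
  · have hzy : z < y := lt_of_le_of_ne hz.2 fun h => hy.1 (h ▸ hzC)
    have : z ∈ C.filter (· < x) := by
      rw [h3]; exact Finset.mem_filter.2 ⟨hzC, hzy⟩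
    exact absurd (Finset.mem_filter.1 this).2 (not_lt.2 hz.1)
  · exact hy.2 ▸ Finset.card_le_card h2
  · exact hx.2 ▸ Finset.card_le_card h1

lemma gapPiece_mem_nhds {C : Finset ℝ} {k : ℕ} {z : ℝ} (hz : z ∈ gapPiece C k) :
    gapPiece C k ∈ 𝓝 z := by
  have h : ∀ᶠ x in 𝓝 z, ∀ c ∈ C, x ≠ c ∧ (c < x ↔ c < z) := by
    rw [Filter.eventually_all_finset]
    intro c hc
    rcases lt_trichotomy c z with h | h | h
    · filter_upwards [lt_mem_nhds h] with x hx
      exact ⟨hx.ne', by simp [hx, h]⟩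
    · exact absurd (h ▸ hc) hz.1
    · filter_upwards [gt_mem_nhds h] with x hx
      exact ⟨hx.ne, iff_of_false hx.not_gt h.not_gt⟩
  filter_upwards [h] with x hx
  refine ⟨fun hxC => (hx x hxC).1 rfl, ?_⟩
  rw [← hz.2]
  congr 1
  exact Finset.filter_congr fun c hc => (hx c hc).2

lemma isOpen_gapPiece (C : Finset ℝ) (k : ℕ) : IsOpen (gapPiece C k) :=
  isOpen_iff_mem_nhds.2 fun _ => gapPiece_mem_nhds

lemma disjoint_gapPiece (C : Finset ℝ) : Pairwise (Function.onFun Disjoint (gapPiece C)) := by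
  intro i j hij
  rw [Function.onFun, Set.disjoint_left]
  exact fun x hi hj => hij (hi.2.symm.trans hj.2)

lemma mem_gapPiece {C : Finset ℝ} {x : ℝ} (hx : x ∉ C) :
    x ∈ gapPiece C (C.filter (· < x)).card := ⟨hx, rfl⟩

lemma iUnion_gapPiece (C : Finset ℝ) :
    ⋃ k ∈ Finset.range (C.card + 1), gapPiece C k = (C : Set ℝ)ᶜ := by
  ext x
  simp only [Set.mem_iUnion, Set.mem_compl_iff, Finset.mem_coe, Finset.mem_range, exists_prop]
  refine ⟨fun ⟨k, _, hk⟩ => hk.1, fun hx => ⟨_, ?_, mem_gapPiece hx⟩⟩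
  exact Nat.lt_succ_of_le (Finset.card_filter_le _ _)

section

variable {g g' : ℝ → ℝ} (hg : ∀ x, HasDerivAt g (g' x) x) {C : Finset ℝ}
  (hC : ∀ x, g' x = 0 → x ∈ C)
include hg hC

/-- Rolle: two equal values in a piece would produce a critical point inside it. -/
lemma injOn_gapPiece (k : ℕ) : Set.InjOn g (gapPiece C k) := by
  have key : ∀ x ∈ gapPiece C k, ∀ y ∈ gapPiece C k, x < y → g x ≠ g y := by
    intro x hx y hy hxy h
    obtain ⟨c, hc, hc0⟩ := exists_hasDerivAt_eq_zero hxy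
      (fun z _ => (hg z).continuousAt.continuousWithinAt) h fun z _ => hg z
    exact ((ordConnected_gapPiece C k).out hx hy ⟨hc.1.le, hc.2.le⟩).1 (hC c hc0)
  intro x hx y hy h
  rcases lt_trichotomy x y with h' | h' | h'
  · exact absurd h (key x hx y hy h')
  · exact h'
  · exact absurd h.symm (key y hy x hx h')

/-- The integral of `|g'|` over `{|g| < ε}` is a finite sum of lengths, one for each interval of
monotonicity of `g`. -/
lemma lintegral_enorm_deriv_eq_sum (ε : ℝ) :
    ∫⁻ x in {x | |g x| < ε}, ‖g' x‖ₑ = ∑ k ∈ Finset.range (C.card + 1),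
      volume (g '' gapPiece C k ∩ Set.Ioo (-ε) ε) := by
  have hgc : Continuous g := continuous_iff_continuousAt.2 fun x => (hg x).continuousAt
  have hm : MeasurableSet {x | |g x| < ε} :=
    (isOpen_lt hgc.abs continuous_const).measurableSet
  have h1 : ({x | |g x| < ε} : Set ℝ) =ᵐ[volume]
      ⋃ k ∈ Finset.range (C.card + 1), (gapPiece C k ∩ {x | |g x| < ε}) := by
    have : (⋃ k ∈ Finset.range (C.card + 1), (gapPiece C k ∩ {x | |g x| < ε})) =
        {x | |g x| < ε} \ (C : Set ℝ) := by
      rw [← Set.iUnion₂_inter, iUnion_gapPiece, Set.inter_comm]; rfl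
    rw [this]
    exact (sdiff_null_ae_eq_self (C.finite_toSet.measure_zero volume)).symm
  rw [setLIntegral_congr h1, lintegral_biUnion_finset
    (fun i _ j _ hij => (disjoint_gapPiece C hij).mono Set.inter_subset_left Set.inter_subset_left)
    (fun k _ => (isOpen_gapPiece C k).measurableSet.inter hm)]
  refine Finset.sum_congr rfl fun k _ => ?_
  -- Change of variables on an injective piece: the integral of `|g'|` is the length of the image.
  have h2 := lintegral_image_eq_lintegral_abs_deriv_mul
    ((isOpen_gapPiece C k).measurableSet.inter hm)
    (fun x _ => (hg x).hasDerivWithinAt) ((injOn_gapPiece hg hC k).mono Set.inter_subset_left)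
    (fun _ => 1)
  simp only [mul_one, lintegral_one, Measure.restrict_apply_univ] at h2
  have h3 : g '' (gapPiece C k ∩ {x | |g x| < ε}) = g '' gapPiece C k ∩ Set.Ioo (-ε) ε := by
    rw [← Set.image_inter_preimage]
    congr 2
    ext x
    simp [abs_lt]
  rw [← h3, h2]
  refine lintegral_congr fun x => ?_
  rw [← Real.norm_eq_abs, ofReal_norm]

/-- Each piece contributes at most the length of `(-ε, ε)`. After normalization the bound is
independent of `ε`, as domination requires. -/
lemma lintegral_enorm_deriv_le (ε : ℝ) :
    ∫⁻ x in {x | |g x| < ε}, ‖g' x‖ₑ ≤ (C.card + 1 : ℕ) * ENNReal.ofReal (2 * ε) := by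
  rw [lintegral_enorm_deriv_eq_sum hg hC]
  refine (Finset.sum_le_card_nsmul _ _ (ENNReal.ofReal (2 * ε)) fun k _ => ?_).trans ?_
  · refine (measure_mono Set.inter_subset_right).trans ?_
    rw [Real.volume_Ioo, sub_neg_eq_add, two_mul]
  · simp

/-- If `g` has only simple zeros and stays away from zero near infinity, then its zeros are counted
by the normalized integral of `|g'|` over `{|g| < ε}` for small `ε`. -/
theorem eventually_lintegral_enorm_deriv_eq (hz : ∀ x, g x = 0 → x ∉ C)
    (hinf : ∃ R δ : ℝ, 0 < δ ∧ ∀ x, R < |x| → δ ≤ |g x|) :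
    ∀ᶠ ε in 𝓝[>] (0 : ℝ), (ENNReal.ofReal (2 * ε))⁻¹ * ∫⁻ x in {x | |g x| < ε}, ‖g' x‖ₑ =
      (({x | g x = 0}.encard : ℕ∞) : ℝ≥0∞) := by
  classical
  have hgc : Continuous g := continuous_iff_continuousAt.2 fun x => (hg x).continuousAt
  set S := (Finset.range (C.card + 1)).filter fun k => ∃ z ∈ gapPiece C k, g z = 0 with hS
  -- Zeros avoid `C`, and a piece contains at most one of them, so zeros correspond to pieces
  -- containing a zero.
  have hcard : {x | g x = 0}.encard = (S.card : ℕ∞) := by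
    have hinj : Set.InjOn (fun x => (C.filter (· < x)).card) {x | g x = 0} := by
      intro x hx y hy hxy
      have hy' := mem_gapPiece (hz y hy)
      rw [← show (C.filter (· < x)).card = (C.filter (· < y)).card from hxy] at hy'
      exact injOn_gapPiece hg hC _ (mem_gapPiece (hz x hx)) hy' (hx.trans hy.symm)
    rw [← hinj.encard_image, ← Set.encard_coe_eq_coe_finsetCard]
    congr 1
    ext k
    simp only [hS, Set.mem_image, Set.mem_ofPred_eq, Finset.coe_filter, Finset.mem_range]
    constructor
    · rintro ⟨x, hx, rfl⟩
      exact ⟨Nat.lt_succ_of_le (Finset.card_filter_le _ _), x, mem_gapPiece (hz x hx), hx⟩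
    · rintro ⟨_, x, hxk, hx⟩
      exact ⟨x, hx, hxk.2⟩
  have hpiece (k : ℕ) : ∀ᶠ ε in 𝓝[>] (0 : ℝ), volume (g '' gapPiece C k ∩ Set.Ioo (-ε) ε) =
      if ∃ z ∈ gapPiece C k, g z = 0 then ENNReal.ofReal (2 * ε) else 0 := by
    split_ifs with h
    · obtain ⟨z, hzk, hz0⟩ := h
      -- `g` is strictly monotone around `z`, so by the intermediate value theorem the image covers
      -- `(-ε, ε)` for small `ε`.
      have himg : g '' gapPiece C k ∈ 𝓝 (0 : ℝ) := by
        obtain ⟨a, b, hab, hsub⟩ := mem_nhds_iff_exists_Ioo_subset.1 (gapPiece_mem_nhds hzk)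
        obtain ⟨a', ha'⟩ := exists_between hab.1
        obtain ⟨b', hb'⟩ := exists_between hab.2
        have hIcc : Set.Icc a' b' ⊆ gapPiece C k := fun x hx =>
          hsub ⟨ha'.1.trans_le hx.1, hx.2.trans_lt hb'.2⟩
        have hi := (injOn_gapPiece hg hC k).mono hIcc
        have hlt : a' < b' := ha'.2.trans hb'.1
        rcases hgc.continuousOn.strictMonoOn_of_injOn_Icc' hlt.le hi with hm | hm
        · have h1 : g a' < 0 := hz0 ▸ hm ⟨le_rfl, hlt.le⟩ ⟨ha'.2.le, hb'.1.le⟩ ha'.2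
          have h2 : 0 < g b' := hz0 ▸ hm ⟨ha'.2.le, hb'.1.le⟩ ⟨hlt.le, le_rfl⟩ hb'.1
          exact mem_of_superset (Icc_mem_nhds h1 h2)
            ((intermediate_value_Icc hlt.le hgc.continuousOn).trans (Set.image_mono hIcc))
        · have h1 : 0 < g a' := hz0 ▸ hm ⟨le_rfl, hlt.le⟩ ⟨ha'.2.le, hb'.1.le⟩ ha'.2
          have h2 : g b' < 0 := hz0 ▸ hm ⟨ha'.2.le, hb'.1.le⟩ ⟨hlt.le, le_rfl⟩ hb'.1
          exact mem_of_superset (Icc_mem_nhds h2 h1)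
            ((intermediate_value_Icc' hlt.le hgc.continuousOn).trans (Set.image_mono hIcc))
      obtain ⟨δ, hδ, hball⟩ := Metric.mem_nhds_iff.1 himg
      filter_upwards [Ioo_mem_nhdsGT hδ] with ε hε
      rw [Set.inter_eq_self_of_subset_right, Real.volume_Ioo, sub_neg_eq_add, two_mul]
      refine Set.Subset.trans (fun u hu => ?_) hball
      rw [mem_ball_zero_iff, Real.norm_eq_abs]
      exact (abs_lt.2 hu).trans hε.2
    · obtain ⟨R, δ, hδ, hR⟩ := hinf
      -- On a piece without zeros `|g|` is bounded below: by compactness of the closure near the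
      -- origin, by `hinf` elsewhere. A zero in the closure would lie in an open piece meeting this
      -- one, hence in this one.
      have hK : IsCompact (closure (gapPiece C k) ∩ Set.Icc (-R) R) :=
        isCompact_Icc.inter_left isClosed_closure
      have hpos : ∀ x ∈ closure (gapPiece C k) ∩ Set.Icc (-R) R, 0 < |g x| := by
        rintro x ⟨hx, -⟩
        refine abs_pos.2 fun hx0 => h ?_
        have hxm := mem_gapPiece (hz x hx0)
        obtain ⟨y, hy1, hy2⟩ := mem_closure_iff_nhds.1 hx _ (gapPiece_mem_nhds hxm)
        have : (C.filter (· < x)).card = k := hy1.2.symm.trans hy2.2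
        exact ⟨x, this ▸ hxm, hx0⟩
      obtain ⟨δ', hδ', hmin⟩ := hK.exists_forall_le' hgc.abs.continuousOn hpos
      filter_upwards [Ioo_mem_nhdsGT (lt_min hδ hδ')] with ε hε
      suffices g '' gapPiece C k ∩ Set.Ioo (-ε) ε = ∅ by rw [this, measure_empty]
      rw [Set.eq_empty_iff_forall_notMem]
      rintro _ ⟨⟨x, hx, rfl⟩, hxε⟩
      have hlt := abs_lt.2 hxε
      by_cases hxR : R < |x|
      · exact absurd (hR x hxR) (not_le.2 (hlt.trans (hε.2.trans_le (min_le_left _ _))))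
      · refine absurd (hmin x ⟨subset_closure hx, abs_le.1 (not_lt.1 hxR)⟩) (not_le.2 ?_)
        exact hlt.trans (hε.2.trans_le (min_le_right _ _))
  have hall : ∀ᶠ ε in 𝓝[>] (0 : ℝ), ∀ k ∈ Finset.range (C.card + 1),
      volume (g '' gapPiece C k ∩ Set.Ioo (-ε) ε) =
      if ∃ z ∈ gapPiece C k, g z = 0 then ENNReal.ofReal (2 * ε) else 0 :=
    (Filter.eventually_all_finset _).2 fun k _ => hpiece k
  filter_upwards [hall, self_mem_nhdsWithin] with ε hε hε0
  rw [lintegral_enorm_deriv_eq_sum hg hC, Finset.sum_congr rfl hε, ← Finset.sum_filter, ← hS,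
    Finset.sum_const, hcard, nsmul_eq_mul, mul_left_comm, ENNReal.inv_mul_cancel, mul_one]
  · simp
  · have : (0 : ℝ) < ε := hε0
    simpa using this
  · exact ENNReal.ofReal_ne_top

end

/-! ### Counting zeros of a generic polynomial. -/

lemma one_le_sqrt_one_add_sq (x : ℝ) : 1 ≤ √(1 + x ^ 2) :=
  Real.one_le_sqrt.2 (by nlinarith [sq_nonneg x])

lemma sphereEval_eq_zero_iff {d : ℕ} {x : ℝ} {p : ℝ[X]} :
    sphereEval d x p = 0 ↔ p.eval x = 0 := by
  have := one_le_sqrt_one_add_sq x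
  rw [sphereEval_apply, mul_eq_zero, or_iff_right (by positivity)]

lemma abs_sphereEval_le (d : ℕ) (x : ℝ) (p : ℝ[X]) : |sphereEval d x p| ≤ |p.eval x| := by
  have h := one_le_pow₀ (n := d) (one_le_sqrt_one_add_sq x)
  rw [sphereEval_apply, abs_mul, abs_of_nonneg (by positivity)]
  exact mul_le_of_le_one_left (abs_nonneg _) (inv_le_one_of_one_le₀ h)

/-- The numerator of the derivative of `x ↦ p(x) / (1 + x²) ^ (d / 2)`. -/
def sphereDerivNum (d : ℕ) (p : ℝ[X]) : ℝ[X] :=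
  (1 + Polynomial.X ^ 2) * Polynomial.derivative p - Polynomial.C (d : ℝ) * Polynomial.X * p

lemma eval_sphereDerivNum (d : ℕ) (p : ℝ[X]) (x : ℝ) : (sphereDerivNum d p).eval x =
    (1 + x ^ 2) * (Polynomial.derivative p).eval x - d * x * p.eval x := by
  simp [sphereDerivNum]

lemma sphereDeriv_eq_zero_iff {d : ℕ} {x : ℝ} {p : ℝ[X]} :
    sphereDeriv d x p = 0 ↔ (sphereDerivNum d p).eval x = 0 := by
  have := one_le_sqrt_one_add_sq x
  rw [sphereDeriv_apply, eval_sphereDerivNum, mul_eq_zero, or_iff_right (by positivity)]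

lemma natDegree_sphereDerivNum_le {d : ℕ} {p : ℝ[X]} (hp : p.natDegree ≤ d) :
    (sphereDerivNum d p).natDegree ≤ d + 1 := by
  refine (Polynomial.natDegree_sub_le _ _).trans (max_le ?_ ?_)
  · rcases eq_or_ne p.natDegree 0 with h | h
    · rw [Polynomial.derivative_of_natDegree_zero h]; simp
    refine Polynomial.natDegree_mul_le.trans ?_
    have h1 : (1 + Polynomial.X ^ 2 : ℝ[X]).natDegree ≤ 2 := by compute_degree
    have h2 := Polynomial.natDegree_derivative_lt h
    omega
  · refine Polynomial.natDegree_mul_le.trans ?_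
    have h1 : (Polynomial.C (d : ℝ) * Polynomial.X : ℝ[X]).natDegree ≤ 1 := by compute_degree
    omega

/-- The genericity conditions that the random polynomial satisfies almost surely. -/
structure IsGenericPoly (d : ℕ) (p : ℝ[X]) : Prop where
  coeff_ne_zero : p.coeff d ≠ 0
  derivative_ne_zero : (Polynomial.derivative p).eval 0 ≠ 0
  simple_zeros : ∀ x, p.eval x = 0 → (Polynomial.derivative p).eval x ≠ 0

/-- No zero escapes to infinity: `p(x) = x^d r(1/x)` for the reflected polynomial `r`, and `r(0)` is
the coefficient of degree `d`. The factor `(1/2)^d` comes from `√(1 + x²) ≤ 2|x|` when `|x| > 1`. -/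
lemma exists_le_abs_sphereEval {d : ℕ} {p : ℝ[X]} (hp : p.natDegree ≤ d) (hc : p.coeff d ≠ 0) :
    ∃ R δ : ℝ, 0 < δ ∧ ∀ x, R < |x| → δ ≤ |sphereEval d x p| := by
  set r := p.reflect d with hr
  have hr0 : r.eval 0 = p.coeff d := by
    rw [← Polynomial.coeff_zero_eq_eval_zero, hr, Polynomial.coeff_reflect]
    simp [Polynomial.revAt_le]
  have hpos : |p.coeff d| / 2 < |r.eval 0| := by
    rw [hr0]; exact half_lt_self (abs_pos.2 hc)
  obtain ⟨η, hη, hball⟩ := Metric.eventually_nhds_iff.1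
    (r.continuous.abs.continuousAt.eventually_const_lt hpos)
  refine ⟨max 1 η⁻¹, (1 / 2) ^ d * (|p.coeff d| / 2), by positivity, fun x hx => ?_⟩
  have hx1 : 1 < |x| := (le_max_left _ _).trans_lt hx
  have hx0 : 0 < |x| := one_pos.trans hx1
  have hxη : |x⁻¹| < η := by
    rw [abs_inv]
    exact inv_lt_of_inv_lt₀ hη ((le_max_right _ _).trans_lt hx)
  have hval := hball (y := x⁻¹) (by simpa [Real.dist_eq] using hxη)
  have := invertibleOfNonzero (abs_pos.1 hx0)
  have hev : r.eval x⁻¹ * x ^ d = p.eval x := by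
    have := Polynomial.eval₂_reflect_mul_pow (RingHom.id ℝ) x d p hp
    simpa [Polynomial.eval₂_eq_eval_map] using this
  have hs : √(1 + x ^ 2) ≤ 2 * |x| := by
    rw [Real.sqrt_le_left (by positivity), mul_pow, sq_abs]
    nlinarith [sq_abs x]
  have hs1 := one_le_sqrt_one_add_sq x
  rw [sphereEval_apply, ← hev, abs_mul, abs_mul, abs_pow,
    abs_of_nonneg (a := (√(1 + x ^ 2) ^ d)⁻¹) (by positivity)]
  calc (1 / 2) ^ d * (|p.coeff d| / 2) ≤ (√(1 + x ^ 2) ^ d)⁻¹ * |x| ^ d * |r.eval x⁻¹| := by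
        gcongr
        rw [inv_mul_eq_div, ← div_pow]
        refine pow_le_pow_left₀ (by norm_num) ?_ d
        rw [div_le_div_iff₀ two_pos (by positivity)]
        linarith
    _ = _ := by ring

/-- The normalized integral approximating the number of zeros of `p`. -/
def zeroApprox (d : ℕ) (p : ℝ[X]) (ε : ℝ) : ℝ≥0∞ :=
  (ENNReal.ofReal (2 * ε))⁻¹ * ∫⁻ x in {x | |sphereEval d x p| < ε}, ‖sphereDeriv d x p‖ₑ

namespace IsGenericPoly

variable {d : ℕ} {p : ℝ[X]} (h : IsGenericPoly d p)
include h

/-- At `0` the numerator equals `p'(0)`. The condition excludes multiples of `(1 + x²)^(d/2)` for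
even `d`, whose normalization is constant. -/
lemma sphereDerivNum_ne_zero : sphereDerivNum d p ≠ 0 := by
  intro h0
  have := eval_sphereDerivNum d p 0
  rw [h0] at this
  simp at this
  exact h.derivative_ne_zero this.symm

lemma mem_roots_of_sphereDeriv_eq_zero (x : ℝ) (hx : sphereDeriv d x p = 0) :
    x ∈ (sphereDerivNum d p).roots.toFinset := by
  rw [Multiset.mem_toFinset, Polynomial.mem_roots h.sphereDerivNum_ne_zero]
  exact sphereDeriv_eq_zero_iff.1 hx

lemma zeroApprox_le (hp : p.natDegree ≤ d) {ε : ℝ} (hε : 0 < ε) :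
    zeroApprox d p ε ≤ (d + 2 : ℕ) := by
  -- The numerator has degree at most `d + 1`, and `d + 1` critical points cut the line into `d + 2`
  -- pieces.
  have hcard : (sphereDerivNum d p).roots.toFinset.card + 1 ≤ d + 2 := by
    have h1 := Multiset.toFinset_card_le (sphereDerivNum d p).roots
    have h2 := (sphereDerivNum d p).card_roots'
    have h3 := natDegree_sphereDerivNum_le hp
    omega
  have hb := lintegral_enorm_deriv_le (fun x => hasDerivAt_sphereEval d x p)
    h.mem_roots_of_sphereDeriv_eq_zero ε
  rw [zeroApprox]
  calc _ ≤ (ENNReal.ofReal (2 * ε))⁻¹ * ((d + 2 : ℕ) * ENNReal.ofReal (2 * ε)) := by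
        gcongr
        exact hb.trans (by gcongr)
    _ = (d + 2 : ℕ) := by
        rw [mul_left_comm, ENNReal.inv_mul_cancel _ ENNReal.ofReal_ne_top, mul_one]
        simpa using hε

lemma eventually_zeroApprox_eq (hp : p.natDegree ≤ d) : ∀ᶠ ε in 𝓝[>] (0 : ℝ),
    zeroApprox d p ε = (({x | p.eval x = 0}.encard : ℕ∞) : ℝ≥0∞) := by
  have := eventually_lintegral_enorm_deriv_eq (fun x => hasDerivAt_sphereEval d x p)
    h.mem_roots_of_sphereDeriv_eq_zero (fun x hx hx' => ?_)
    (exists_le_abs_sphereEval hp h.coeff_ne_zero)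
  · simpa only [zeroApprox, sphereEval_eq_zero_iff] using this
  · rw [sphereEval_eq_zero_iff] at hx
    rw [Multiset.mem_toFinset, Polynomial.mem_roots h.sphereDerivNum_ne_zero, Polynomial.IsRoot,
      eval_sphereDerivNum, hx, mul_zero, sub_zero, mul_eq_zero] at hx'
    exact hx'.elim (fun h => by nlinarith [sq_nonneg x]) (h.simple_zeros x hx)

/-- If all zeros are simple and the data point is not a zero, then every zero carries exactly one
ED critical point. -/
lemma realEDCount_eq {ξ : ℝ} (hξ : p.eval ξ ≠ 0) :
    realEDCount (fun x => p.eval x) ξ = (({x | p.eval x = 0}.encard : ℕ∞) : ℝ≥0∞) := by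
  rw [realEDCount]
  congr 1
  have hinj : Set.InjOn (Prod.fst : ℝ × ℝ → ℝ)
      {q | q ∈ Set.univ ×ˢ ({0}ᶜ : Set ℝ) ∧ edSystem (fun x => p.eval x) ξ q = 0} := by
    rintro ⟨x, l⟩ ⟨-, h1⟩ ⟨y, m⟩ ⟨-, h2⟩ (rfl : x = y)
    simp only [edSystem, Polynomial.deriv, Prod.mk_eq_zero] at h1 h2
    have : (l - m) * (Polynomial.derivative p).eval x = 0 := by linear_combination h1.2 - h2.2
    rw [mul_eq_zero, or_iff_left (h.simple_zeros x h1.1), sub_eq_zero] at this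
    rw [this]
  rw [← hinj.encard_image]
  congr 1
  ext x
  simp only [Set.mem_image, Set.mem_ofPred_eq, Prod.exists, exists_and_right, exists_eq_right,
    edSystem, Polynomial.deriv, Prod.mk_eq_zero, Set.mem_prod, Set.mem_univ, true_and,
    Set.mem_compl_iff, Set.mem_singleton_iff]
  refine ⟨fun ⟨_, _, h1, _⟩ => h1, fun hx => ?_⟩
  have hd := h.simple_zeros x hx
  refine ⟨(ξ - x) / (Polynomial.derivative p).eval x, ?_, hx, ?_⟩
  · refine div_ne_zero (sub_ne_zero.2 fun h => hξ (h ▸ hx)) hd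
  · rw [div_mul_cancel₀ _ hd]; ring

end IsGenericPoly

/-! ### Small-ball estimates and almost sure genericity. -/

/-- Near a double zero of `p`, the set where `|p| < 1 / n²` has length at least of order `1 / n`. -/
lemma exists_le_mul_volume_of_double_zero (d : ℕ) {p : ℝ[X]} {x₀ R : ℝ} (hx₀ : |x₀| < R)
    (h0 : p.eval x₀ = 0) (h1 : (Polynomial.derivative p).eval x₀ = 0) :
    ∃ c : ℝ≥0∞, 0 < c ∧ ∀ᶠ n : ℕ in atTop, c ≤ n *
      volume.restrict (Set.Icc (-R) R) {x | |sphereEval d x p| < 1 / (n : ℝ) ^ 2} := by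
  obtain ⟨q, hq⟩ : ∃ q : ℝ[X], p = (Polynomial.X - Polynomial.C x₀) ^ 2 * q := by
    obtain ⟨u, hu⟩ := Polynomial.dvd_iff_isRoot.2 h0
    have hu0 : u.eval x₀ = 0 := by
      rw [hu] at h1
      simpa using h1
    obtain ⟨q, hq⟩ := Polynomial.dvd_iff_isRoot.2 hu0
    exact ⟨q, by rw [hu, hq]; ring⟩
  obtain ⟨K, hK⟩ := (isCompact_Icc (a := -R) (b := R)).exists_bound_of_continuousOn
    q.continuous.continuousOn
  set M := max K 1 with hM
  have hM1 : 1 ≤ M := le_max_right _ _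
  have hM0 : 0 < M := one_pos.trans_le hM1
  refine ⟨ENNReal.ofReal (2 / M), by simpa using hM0, ?_⟩
  have hn : Tendsto (fun n : ℕ => 1 / (n : ℝ)) atTop (𝓝 0) := tendsto_one_div_atTop_nhds_zero_nat
  filter_upwards [hn.eventually_lt_const (sub_pos.2 hx₀), eventually_gt_atTop 0] with n hn hn0
  have hn0' : (0 : ℝ) < n := by exact_mod_cast hn0
  -- Since `|p| ≤ M |x - x₀|²` on the window, this radius gives `|p| < 1 / (n² M) ≤ 1 / n²`, and `n
  -- · 2r = 2 / M` is the constant chosen above.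
  set r := 1 / (n * M) with hr
  have hr0 : 0 < r := by positivity
  have hrn : r ≤ 1 / n := by
    rw [hr]
    exact one_div_le_one_div_of_le hn0' (le_mul_of_one_le_right hn0'.le hM1)
  have hsub : Set.Ioo (x₀ - r) (x₀ + r) ⊆
      {x | |sphereEval d x p| < 1 / (n : ℝ) ^ 2} ∩ Set.Icc (-R) R := by
    intro x hx
    have hxr : |x - x₀| < r := abs_lt.2 ⟨by linarith [hx.1], by linarith [hx.2]⟩
    have hxR : x ∈ Set.Icc (-R) R := by
      have := abs_le.1 (le_refl |x₀|)
      exact ⟨by linarith [hx.1], by linarith [hx.2]⟩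
    refine ⟨(abs_sphereEval_le d x p).trans_lt ?_, hxR⟩
    have h2 : |q.eval x| ≤ M := (hK x hxR).trans (le_max_left _ _)
    rw [hq]
    simp only [Polynomial.eval_mul, Polynomial.eval_pow, Polynomial.eval_sub, Polynomial.eval_X,
      Polynomial.eval_C, abs_mul, abs_pow]
    calc |x - x₀| ^ 2 * |q.eval x| ≤ |x - x₀| ^ 2 * M := by gcongr
      _ < r ^ 2 * M := by gcongr
      _ = 1 / (n : ℝ) ^ 2 * (1 / M) := by rw [hr]; field_simp
      _ ≤ 1 / (n : ℝ) ^ 2 :=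
        mul_le_of_le_one_right (by positivity) (by rw [div_le_one hM0]; exact hM1)
  calc ENNReal.ofReal (2 / M) = n * volume (Set.Ioo (x₀ - r) (x₀ + r)) := by
        rw [Real.volume_Ioo, ← ENNReal.ofReal_natCast, ← ENNReal.ofReal_mul hn0'.le]
        congr 1
        rw [hr]; field_simp; ring
    _ ≤ _ := mul_le_mul_right
        ((measure_mono hsub).trans (Measure.le_restrict_apply _ _)) _

lemma gaussianReal_Ioo_le {v : ℝ≥0} (hv : v ≠ 0) (ε : ℝ) :
    gaussianReal 0 v (Set.Ioo (-ε) ε) ≤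
      ENNReal.ofReal (2 * ε) * ENNReal.ofReal (√(2 * Real.pi * v))⁻¹ := by
  rw [gaussianReal_apply _ hv]
  have h : ∀ x, gaussianPDF 0 v x ≤ ENNReal.ofReal (√(2 * Real.pi * v))⁻¹ := fun x => by
    refine ENNReal.ofReal_le_ofReal ?_
    rw [gaussianPDFReal_zero]
    refine mul_le_of_le_one_right (by positivity) (Real.exp_le_one_iff.2 ?_)
    rw [neg_div, neg_nonpos]
    positivity
  refine (setLIntegral_mono measurable_const fun x _ => h x).trans_eq ?_
  rw [setLIntegral_const, Real.volume_Ioo, mul_comm, sub_neg_eq_add, two_mul ε]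

lemma le_gaussianReal_Ioo {v : ℝ≥0} (hv : v ≠ 0) (ε : ℝ) :
    ENNReal.ofReal (2 * ε) * gaussianPDF 0 v ε ≤ gaussianReal 0 v (Set.Ioo (-ε) ε) := by
  rw [gaussianReal_apply _ hv]
  have h : ∀ x ∈ Set.Ioo (-ε) ε, gaussianPDF 0 v ε ≤ gaussianPDF 0 v x := fun x hx => by
    refine ENNReal.ofReal_le_ofReal ?_
    rw [gaussianPDFReal_zero, gaussianPDFReal_zero]
    have : x ^ 2 ≤ ε ^ 2 := sq_le_sq' hx.1.le hx.2.le
    gcongr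
  refine le_of_eq_of_le ?_ (setLIntegral_mono (measurable_gaussianPDF 0 v) h)
  rw [setLIntegral_const, Real.volume_Ioo, mul_comm, sub_neg_eq_add, two_mul]

/-- The mean density over `(-ε, ε)` lies between the density at `ε` and the density at `0`. -/
lemma tendsto_gaussianReal_Ioo {v : ℝ≥0} (hv : v ≠ 0) :
    Tendsto (fun ε : ℝ => (ENNReal.ofReal (2 * ε))⁻¹ * gaussianReal 0 v (Set.Ioo (-ε) ε))
      (𝓝[>] 0) (𝓝 (ENNReal.ofReal (√(2 * Real.pi * v))⁻¹)) := by
  have hlow : Tendsto (fun ε : ℝ => gaussianPDF 0 v ε) (𝓝[>] 0)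
      (𝓝 (ENNReal.ofReal (√(2 * Real.pi * v))⁻¹)) := by
    have hc : Continuous (gaussianPDFReal 0 v) := by
      rw [show gaussianPDFReal 0 v = fun x => (√(2 * Real.pi * v))⁻¹ *
        Real.exp (-x ^ 2 / (2 * v)) from funext (gaussianPDFReal_zero v)]
      fun_prop
    have := (ENNReal.tendsto_ofReal (hc.tendsto 0)).mono_left
      (nhdsWithin_le_nhds (s := Set.Ioi 0))
    simpa [gaussianPDFReal_zero, gaussianPDF_def] using this
  have hcancel : ∀ ε : ℝ, 0 < ε → ∀ a : ℝ≥0∞,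
      (ENNReal.ofReal (2 * ε))⁻¹ * (ENNReal.ofReal (2 * ε) * a) = a := fun ε hε a => by
    rw [← mul_assoc, ENNReal.inv_mul_cancel (by simpa using hε) ENNReal.ofReal_ne_top, one_mul]
  refine tendsto_of_tendsto_of_tendsto_of_le_of_le' hlow tendsto_const_nhds ?_ ?_
  · filter_upwards [self_mem_nhdsWithin] with ε hε
    rw [← hcancel ε hε (gaussianPDF 0 v ε)]
    exact mul_le_mul_right (le_gaussianReal_Ioo hv ε) _
  · filter_upwards [self_mem_nhdsWithin] with ε hε
    rw [← hcancel ε hε (ENNReal.ofReal (√(2 * Real.pi * v))⁻¹)]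
    exact mul_le_mul_right (gaussianReal_Ioo_le hv ε) _

/-- The variance of the normalized value of the random polynomial. -/
def sphereVar (d : ℕ) : ℝ≥0 := (gaussianMoment d).toNNReal

/-- The variance of the derivative of the normalized random polynomial at `x`. -/
def sphereDerivVar (d : ℕ) (x : ℝ) : ℝ≥0 :=
  (d ^ 2 * gaussianMoment (d - 1) / (1 + x ^ 2) ^ 2).toNNReal

lemma sphereVar_ne_zero (d : ℕ) : sphereVar d ≠ 0 := by
  simpa [sphereVar] using gaussianMoment_pos d

namespace IsNeuronGaussianPoly

variable {Ω : Type*} [MeasurableSpace Ω] {P : Measure Ω} {d : ℕ}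
  {p : Ω → ℝ[X]} (hp : IsNeuronGaussianPoly d P p)
include hp

lemma ae_ne_zero {l : ℝ[X] →ₗ[ℝ] ℝ} (hl : 0 < secondMoment d l) : ∀ᵐ ω ∂P, l (p ω) ≠ 0 := by
  have hv : (secondMoment d l).toNNReal ≠ 0 := by simpa using hl
  have := nullSingletonClass_gaussianReal (μ := 0) hv
  have h : ∀ᵐ y ∂(gaussianReal 0 (secondMoment d l).toNNReal), y ≠ 0 := by
    rw [ae_iff]; simp
  rw [← hp.map_eq] at h
  exact ae_of_ae_map (hp.measurable l).aemeasurable h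

lemma map_sphereEval (hd : 1 ≤ d) (x : ℝ) :
    P.map (fun ω => sphereEval d x (p ω)) = gaussianReal 0 (sphereVar d) := by
  have h := secondMoment_sphere hd x 1 0
  simp only [one_smul, zero_smul, add_zero] at h
  rw [hp.map_eq, h, sphereVar]
  simp

lemma measurable_eval : Measurable fun q : Ω × ℝ => (p q.1).eval q.2 := by
  have h : (fun q : Ω × ℝ => (p q.1).eval q.2) =
      fun q => ∑ i ∈ Finset.range (d + 1), Polynomial.lcoeff ℝ i (p q.1) * q.2 ^ i := by
    funext q
    rw [Polynomial.eval_eq_sum_range' (Nat.lt_succ_of_le (hp.natDegree_le q.1))]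
    rfl
  rw [h]
  exact Finset.measurable_fun_sum _ fun i _ =>
    ((hp.measurable _).comp measurable_fst).mul (measurable_snd.pow_const i)

lemma measurable_eval_derivative :
    Measurable fun q : Ω × ℝ => (Polynomial.derivative (p q.1)).eval q.2 := by
  have h : (fun q : Ω × ℝ => (Polynomial.derivative (p q.1)).eval q.2) =
      fun q => ∑ i ∈ Finset.range (d + 1),
        (Polynomial.lcoeff ℝ i ∘ₗ Polynomial.derivative) (p q.1) * q.2 ^ i := by
    funext q
    rw [Polynomial.eval_eq_sum_range' (n := d + 1)]
    · rfl
    · exact Nat.lt_succ_of_le ((Polynomial.natDegree_derivative_le _).trans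
        ((Nat.sub_le _ _).trans (hp.natDegree_le q.1)))
  rw [h]
  exact Finset.measurable_fun_sum _ fun i _ =>
    ((hp.measurable _).comp measurable_fst).mul (measurable_snd.pow_const i)

lemma measurable_sphereEval : Measurable fun q : Ω × ℝ => sphereEval d q.2 (p q.1) := by
  have := hp.measurable_eval
  simp only [sphereEval_apply]
  fun_prop

lemma measurable_sphereDeriv : Measurable fun q : Ω × ℝ => sphereDeriv d q.2 (p q.1) := by
  have := hp.measurable_eval
  have := hp.measurable_eval_derivative
  simp only [sphereDeriv_apply]
  fun_prop

lemma measure_abs_sphereEval_lt (hd : 1 ≤ d) (x ε : ℝ) :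
    P {ω | |sphereEval d x (p ω)| < ε} = gaussianReal 0 (sphereVar d) (Set.Ioo (-ε) ε) := by
  rw [← hp.map_sphereEval hd x, Measure.map_apply (hp.measurable _) measurableSet_Ioo]
  congr 1
  ext ω
  simp [abs_lt]

variable [IsProbabilityMeasure P]

/-- The normalized random polynomial and its derivative at a point are independent. -/
lemma map_sphereEval_sphereDeriv (hd : 1 ≤ d) (x : ℝ) :
    P.map (fun ω => (sphereEval d x (p ω), sphereDeriv d x (p ω))) =
      (gaussianReal 0 (sphereVar d)).prod (gaussianReal 0 (sphereDerivVar d x)) := by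
  have hm : Measurable fun ω => (sphereEval d x (p ω), sphereDeriv d x (p ω)) :=
    (hp.measurable _).prodMk (hp.measurable _)
  have : IsProbabilityMeasure
      (P.map (fun ω => (sphereEval d x (p ω), sphereDeriv d x (p ω)))) :=
    Measure.isProbabilityMeasure_map hm.aemeasurable
  refine Measure.ext_of_charFunDual ?_
  ext L
  have hL : L ∘ (fun ω => (sphereEval d x (p ω), sphereDeriv d x (p ω))) =
      fun ω => (L (1, 0) • sphereEval d x + L (0, 1) • sphereDeriv d x) (p ω) := by
    funext ω
    simp only [Function.comp]
    rw [show (sphereEval d x (p ω), sphereDeriv d x (p ω)) =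
      sphereEval d x (p ω) • ((1, 0) : ℝ × ℝ) + sphereDeriv d x (p ω) • ((0, 1) : ℝ × ℝ) by simp,
      map_add, map_smul, map_smul]
    simp [mul_comm]
  -- The variance of the combination has no cross term, so the characteristic function factorizes,
  -- which is independence.
  rw [charFunDual_eq_charFun_map_one, Measure.map_map (by fun_prop) hm, hL, hp.map_eq,
    secondMoment_sphere hd, charFun_gaussianReal, charFunDual_prod, charFunDual_eq_charFun_map_one,
    charFunDual_eq_charFun_map_one, gaussianReal_map_continuousLinearMap,
    gaussianReal_map_continuousLinearMap, charFun_gaussianReal, charFun_gaussianReal,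
    ← Complex.exp_add]
  have h1 := (gaussianMoment_pos d).le
  have h2 := (gaussianMoment_pos (d - 1)).le
  congr 1
  simp only [sphereVar, sphereDerivVar, ContinuousLinearMap.comp_apply,
    ContinuousLinearMap.inl_apply, ContinuousLinearMap.inr_apply, NNReal.coe_mul, map_zero,
    Real.coe_toNNReal _ (sq_nonneg _), Real.coe_toNNReal _ h1]
  rw [Real.coe_toNNReal _ (by positivity), Real.coe_toNNReal _ (by positivity)]
  push_cast
  ring

/-- Bulinskaya's argument: `|g(x)| < 1 / n²` has probability `O(1 / n²)` uniformly in `x`, so `F n`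
has expectation `O(1 / n)` and by Fatou its liminf vanishes almost surely. A double zero would keep
this liminf positive. -/
lemma ae_simple_zeros_of_abs_lt (hd : 1 ≤ d) (R : ℝ) : ∀ᵐ ω ∂P, ∀ x, |x| < R →
    (p ω).eval x = 0 → (Polynomial.derivative (p ω)).eval x ≠ 0 := by
  set μ : Measure ℝ := volume.restrict (Set.Icc (-R) R) with hμ
  set F : ℕ → Ω → ℝ≥0∞ := fun n ω =>
    n * μ {x | |sphereEval d x (p ω)| < 1 / (n : ℝ) ^ 2} with hF
  have hS (n : ℕ) : MeasurableSet {q : Ω × ℝ | |sphereEval d q.2 (p q.1)| < 1 / (n : ℝ) ^ 2} :=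
    measurableSet_lt hp.measurable_sphereEval.abs measurable_const
  have hSm (n : ℕ) : Measurable fun ω => μ {x | |sphereEval d x (p ω)| < 1 / (n : ℝ) ^ 2} :=
    measurable_measure_prodMk_left (hS n)
  have hFm (n : ℕ) : Measurable (F n) := (hSm n).const_mul _
  set c : ℝ≥0∞ := ENNReal.ofReal (√(2 * Real.pi * sphereVar d))⁻¹ with hc
  have hint (n : ℕ) : ∫⁻ ω, F n ω ∂P ≤ ENNReal.ofReal (n * (2 * (1 / (n : ℝ) ^ 2))) *
      (c * μ Set.univ) := by
    have h1 : ∫⁻ ω, μ {x | |sphereEval d x (p ω)| < 1 / (n : ℝ) ^ 2} ∂P =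
        ∫⁻ x, P {ω | |sphereEval d x (p ω)| < 1 / (n : ℝ) ^ 2} ∂μ :=
      (Measure.prod_apply (hS n)).symm.trans (Measure.prod_apply_symm (hS n))
    simp only [hF]
    rw [lintegral_const_mul _ (hSm n), h1]
    simp only [hp.measure_abs_sphereEval_lt hd, lintegral_const]
    rw [ENNReal.ofReal_mul n.cast_nonneg, ENNReal.ofReal_natCast, mul_assoc, ← mul_assoc _ c]
    gcongr
    exact gaussianReal_Ioo_le (sphereVar_ne_zero d) _
  have hlim : Tendsto (fun n : ℕ => ENNReal.ofReal (n * (2 * (1 / (n : ℝ) ^ 2))) *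
      (c * μ Set.univ)) atTop (𝓝 0) := by
    have h1 : Tendsto (fun n : ℕ => (n : ℝ) * (2 * (1 / (n : ℝ) ^ 2))) atTop (𝓝 0) := by
      have := (tendsto_one_div_atTop_nhds_zero_nat (𝕜 := ℝ)).const_mul 2
      rw [mul_zero] at this
      refine this.congr fun n => ?_
      rcases eq_or_ne n 0 with rfl | hn
      · simp
      · field_simp
    have h2 := ENNReal.Tendsto.mul_const (ENNReal.tendsto_ofReal h1) (b := c * μ Set.univ)
      (Or.inr (ENNReal.mul_ne_top ENNReal.ofReal_ne_top (measure_ne_top _ _)))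
    simpa using h2
  have hzero : ∫⁻ ω, liminf (fun n => F n ω) atTop ∂P = 0 := by
    have h1 := lintegral_liminf_le hFm (μ := P) (u := atTop)
    have h2 : Tendsto (fun n => ∫⁻ ω, F n ω ∂P) atTop (𝓝 0) :=
      tendsto_of_tendsto_of_tendsto_of_le_of_le tendsto_const_nhds hlim (fun _ => zero_le) hint
    rw [h2.liminf_eq] at h1
    exact le_antisymm h1 zero_le
  rw [lintegral_eq_zero_iff (Measurable.liminf hFm)] at hzero
  filter_upwards [hzero] with ω hω x hx h0 h1
  obtain ⟨c, hc0, hc⟩ := exists_le_mul_volume_of_double_zero d hx h0 h1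
  have : c ≤ liminf (fun n => F n ω) atTop := le_liminf_of_le (by isBoundedDefault) hc
  rw [hω] at this
  exact hc0.ne' (le_antisymm this zero_le)

lemma ae_isGenericPoly (hd : 1 ≤ d) : ∀ᵐ ω ∂P, IsGenericPoly d (p ω) := by
  have h1 : ∀ᵐ ω ∂P, (p ω).coeff d ≠ 0 := by
    refine hp.ae_ne_zero (l := Polynomial.lcoeff ℝ d) ?_
    have : secondMoment d (Polynomial.lcoeff ℝ d) = gaussianMoment d := by
      have h (z : ℝ × ℝ) : (Polynomial.lcoeff ℝ d (neuronPoly d z)) ^ 2 = z.1 ^ (2 * d) := by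
        have h1 : (Polynomial.C z.1 * Polynomial.X + Polynomial.C z.2 : ℝ[X]).natDegree ≤ 1 := by
          compute_degree
        have := Polynomial.coeff_pow_of_natDegree_le h1 (m := d)
        rw [mul_one] at this
        rw [Polynomial.lcoeff_apply, neuronPoly, this, mul_comm 2 d, pow_mul]
        simp
      simp only [secondMoment, h]
      have := integral_prod_mul (μ := gaussianReal 0 1) (ν := gaussianReal 0 1)
        (fun x : ℝ => x ^ (2 * d)) (fun _ => 1)
      simpa [innerLaw, gaussianMoment] using this
    rw [this]
    exact gaussianMoment_pos d
  have h2 : ∀ᵐ ω ∂P, (Polynomial.derivative (p ω)).eval 0 ≠ 0 := by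
    -- At `x = 0` the functional `sphereDeriv` is exactly `p ↦ p'(0)`, with variance `d² M_{d-1} >
    -- 0`.
    have h := hp.ae_ne_zero (l := (0 : ℝ) • sphereEval d 0 + (1 : ℝ) • sphereDeriv d 0) (by
      rw [secondMoment_sphere hd]
      have h1 := gaussianMoment_pos (d - 1)
      have h2 : (0 : ℝ) < d := by exact_mod_cast hd
      have h3 := gaussianMoment_pos d
      positivity)
    simpa [sphereDeriv_apply] using h
  have h3 : ∀ᵐ ω ∂P, ∀ n : ℕ, ∀ x : ℝ, |x| < n →
      (p ω).eval x = 0 → (Polynomial.derivative (p ω)).eval x ≠ 0 :=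
    ae_all_iff.2 fun n => hp.ae_simple_zeros_of_abs_lt hd n
  filter_upwards [h1, h2, h3] with ω hω1 hω2 hω3
  refine ⟨hω1, hω2, fun x => ?_⟩
  obtain ⟨n, hn⟩ := exists_nat_gt |x|
  exact hω3 n x hn

end IsNeuronGaussianPoly

/-! ### The Kac–Rice expectation. -/

lemma zeroApprox_eq_lintegral (d : ℕ) (q : ℝ[X]) (ε : ℝ) :
    zeroApprox d q ε = (ENNReal.ofReal (2 * ε))⁻¹ *
      ∫⁻ x, (Set.Ioo (-ε) ε).indicator 1 (sphereEval d x q) * ‖sphereDeriv d x q‖ₑ := by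
  have hc : Continuous fun x => sphereEval d x q :=
    continuous_iff_continuousAt.2 fun x => (hasDerivAt_sphereEval d x q).continuousAt
  rw [zeroApprox, ← lintegral_indicator (isOpen_lt hc.abs continuous_const).measurableSet]
  congr 2 with x
  by_cases hx : |sphereEval d x q| < ε
  · rw [Set.indicator_of_mem (show x ∈ {x | |sphereEval d x q| < ε} from hx),
      Set.indicator_of_mem (show sphereEval d x q ∈ Set.Ioo (-ε) ε from abs_lt.1 hx)]
    simp
  · rw [Set.indicator_of_notMem (show x ∉ {x | |sphereEval d x q| < ε} from hx),
      Set.indicator_of_notMem (show sphereEval d x q ∉ Set.Ioo (-ε) ε from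
        fun h => hx (abs_lt.2 h)), zero_mul]

lemma lintegral_sqrt_sphereDerivVar (d : ℕ) :
    ∫⁻ x, ENNReal.ofReal (√(sphereDerivVar d x) * √(2 / Real.pi)) =
      ENNReal.ofReal (d * √(gaussianMoment (d - 1)) * √(2 / Real.pi) * Real.pi) := by
  have h0 := (gaussianMoment_pos (d - 1)).le
  have h (x : ℝ) : √(sphereDerivVar d x) * √(2 / Real.pi) =
      d * √(gaussianMoment (d - 1)) * √(2 / Real.pi) * (1 + x ^ 2)⁻¹ := by
    rw [sphereDerivVar, Real.coe_toNNReal _ (by positivity), Real.sqrt_div (by positivity),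
      Real.sqrt_sq (by positivity), Real.sqrt_mul (by positivity), Real.sqrt_sq (by positivity)]
    ring
  simp only [h]
  rw [← ofReal_integral_eq_lintegral_ofReal (integrable_inv_one_add_sq.const_mul _)
    (.of_forall fun x => by positivity), integral_const_mul, integral_univ_inv_one_add_sq]

/-- Here `π √(2/π) = √(2π)` cancels the density constant, and `M_d = (2d - 1) M_{d-1}` leaves `d /
√(2d - 1)`. -/
lemma kacRice_constant {d : ℕ} (hd : 1 ≤ d) :
    (√(2 * Real.pi * sphereVar d))⁻¹ *
      (d * √(gaussianMoment (d - 1)) * √(2 / Real.pi) * Real.pi) = d / √(2 * (d : ℝ) - 1) := by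
  have hm := gaussianMoment_pos (d - 1)
  have hpi := Real.pi_pos
  have hM : gaussianMoment d = (2 * d - 1) * gaussianMoment (d - 1) := by
    have := gaussianMoment_succ (d - 1)
    rw [Nat.sub_add_cancel hd, Nat.cast_sub hd] at this
    rw [this]; push_cast; ring
  have h2d : (0 : ℝ) < 2 * d - 1 := by
    have : (1 : ℝ) ≤ d := by exact_mod_cast hd
    linarith
  have hπ : √(2 / Real.pi) * Real.pi = √(2 * Real.pi) := by
    rw [← Real.sqrt_sq hpi.le, ← Real.sqrt_mul' _ (by positivity), Real.sqrt_sq hpi.le]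
    congr 1
    field_simp
  rw [mul_assoc _ (√(2 / Real.pi)), hπ, sphereVar, Real.coe_toNNReal _ (gaussianMoment_pos d).le,
    hM, Real.sqrt_mul (by positivity), Real.sqrt_mul h2d.le]
  have h1 : 0 < √(2 * Real.pi) := by positivity
  have h2 : 0 < √(gaussianMoment (d - 1)) := by positivity
  have h3 : 0 < √(2 * (d : ℝ) - 1) := by positivity
  field_simp

namespace IsNeuronGaussianPoly

variable {Ω : Type*} [MeasurableSpace Ω] {P : Measure Ω} {d : ℕ}
  {p : Ω → ℝ[X]} (hp : IsNeuronGaussianPoly d P p)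
include hp

lemma measurable_zeroApprox_integrand (ε : ℝ) : Measurable fun q : Ω × ℝ =>
    (Set.Ioo (-ε) ε).indicator (1 : ℝ → ℝ≥0∞) (sphereEval d q.2 (p q.1)) *
      ‖sphereDeriv d q.2 (p q.1)‖ₑ :=
  ((measurable_one.indicator measurableSet_Ioo).comp hp.measurable_sphereEval).mul
    hp.measurable_sphereDeriv.enorm

lemma measurable_zeroApprox (ε : ℝ) : Measurable fun ω => zeroApprox d (p ω) ε := by
  simp only [zeroApprox_eq_lintegral]
  exact (hp.measurable_zeroApprox_integrand ε).lintegral_prod_right'.const_mul _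

variable [IsProbabilityMeasure P]

/-- By Tonelli and independence the expectation factorizes exactly for each `ε`; only the mass of
`(-ε, ε)` still has to pass to the limit. -/
lemma lintegral_zeroApprox (hd : 1 ≤ d) (ε : ℝ) : ∫⁻ ω, zeroApprox d (p ω) ε ∂P =
    (ENNReal.ofReal (2 * ε))⁻¹ * gaussianReal 0 (sphereVar d) (Set.Ioo (-ε) ε) *
      ENNReal.ofReal (d * √(gaussianMoment (d - 1)) * √(2 / Real.pi) * Real.pi) := by
  have hm := hp.measurable_zeroApprox_integrand ε
  simp only [zeroApprox_eq_lintegral]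
  rw [lintegral_const_mul _ hm.lintegral_prod_right', lintegral_lintegral_swap hm.aemeasurable,
    mul_assoc, ← lintegral_sqrt_sphereDerivVar, ← lintegral_const_mul' _ _ (measure_ne_top _ _)]
  congr 1
  refine lintegral_congr fun x => ?_
  have h1 : Measurable ((Set.Ioo (-ε) ε).indicator (1 : ℝ → ℝ≥0∞)) :=
    measurable_one.indicator measurableSet_Ioo
  have h2 := lintegral_map (μ := P) (g := fun ω => (sphereEval d x (p ω), sphereDeriv d x (p ω)))
    (f := fun u : ℝ × ℝ => (Set.Ioo (-ε) ε).indicator (1 : ℝ → ℝ≥0∞) u.1 * ‖u.2‖ₑ)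
    ((h1.comp measurable_fst).mul measurable_snd.enorm)
    ((hp.measurable _).prodMk (hp.measurable _))
  rw [← h2, hp.map_sphereEval_sphereDeriv hd, lintegral_prod_mul h1.aemeasurable (by fun_prop),
    lintegral_indicator_one measurableSet_Ioo, lintegral_enorm_gaussianReal]

/-- The Kac–Rice formula for the expected number of real zeros of the random polynomial. -/
theorem lintegral_encard_zeros (hd : 1 ≤ d) :
    AEMeasurable (fun ω => (({x | (p ω).eval x = 0}.encard : ℕ∞) : ℝ≥0∞)) P ∧
      ∫⁻ ω, (({x | (p ω).eval x = 0}.encard : ℕ∞) : ℝ≥0∞) ∂P =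
        ENNReal.ofReal (d / √(2 * (d : ℝ) - 1)) := by
  have hε : Tendsto (fun n : ℕ => 1 / ((n : ℝ) + 1)) atTop (𝓝[>] 0) :=
    tendsto_nhdsWithin_iff.2 ⟨tendsto_one_div_add_atTop_nhds_zero_nat,
      .of_forall fun n => Set.mem_Ioi.2 (by positivity)⟩
  have hlim : ∀ᵐ ω ∂P, Tendsto (fun n : ℕ => zeroApprox d (p ω) (1 / ((n : ℝ) + 1))) atTop
      (𝓝 (({x | (p ω).eval x = 0}.encard : ℕ∞) : ℝ≥0∞)) := by
    filter_upwards [hp.ae_isGenericPoly hd] with ω hω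
    exact tendsto_nhds_of_eventually_eq
      (hε.eventually (hω.eventually_zeroApprox_eq (hp.natDegree_le ω)))
  have hbound (n : ℕ) : ∀ᵐ ω ∂P, zeroApprox d (p ω) (1 / ((n : ℝ) + 1)) ≤ (d + 2 : ℕ) := by
    filter_upwards [hp.ae_isGenericPoly hd] with ω hω
    exact hω.zeroApprox_le (hp.natDegree_le ω) (by positivity)
  refine ⟨aemeasurable_of_tendsto_metrizable_ae' (fun n =>
    (hp.measurable_zeroApprox _).aemeasurable) hlim, ?_⟩
  have h1 := tendsto_lintegral_of_dominated_convergence (fun _ => ((d + 2 : ℕ) : ℝ≥0∞))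
    (fun n => hp.measurable_zeroApprox _) hbound (by simp) hlim
  refine tendsto_nhds_unique h1 ?_
  simp only [hp.lintegral_zeroApprox hd]
  have h2 := ENNReal.Tendsto.mul_const ((tendsto_gaussianReal_Ioo (sphereVar_ne_zero d)).comp hε)
    (Or.inr ENNReal.ofReal_ne_top) (b := ENNReal.ofReal
      (d * √(gaussianMoment (d - 1)) * √(2 / Real.pi) * Real.pi))
  rw [← ENNReal.ofReal_mul (by positivity), kacRice_constant hd] at h2
  exact h2

end IsNeuronGaussianPoly

theorem mainTheorem6 {Ω : Type*} [MeasurableSpace Ω] (P : Measure Ω) [IsProbabilityMeasure P]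
    (d : ℕ) (hd : 1 ≤ d) (f : ℝ → Ω → ℝ) (hf : IsTwoLayerNNGP P (fun z => z ^ d) f) (ξ : ℝ) :
    AEMeasurable (fun ω => realEDCount (fun x => f x ω) ξ) P ∧
      ∫⁻ ω, realEDCount (fun x => f x ω) ξ ∂P
        = ENNReal.ofReal ((d : ℝ) / √(2 * (d : ℝ) - 1)) := by
  obtain ⟨p, hp, hfp⟩ := hf.exists_isNeuronGaussianPoly
  -- If `ξ` were a simple zero, its only multiplier would be the excluded value `λ = 0`.
  have hξ : ∀ᵐ ω ∂P, (p ω).eval ξ ≠ 0 := by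
    have h := hp.ae_ne_zero (l := (1 : ℝ) • sphereEval d ξ + (0 : ℝ) • sphereDeriv d ξ) (by
      rw [secondMoment_sphere hd]
      have h1 := gaussianMoment_pos (d - 1)
      have h3 := gaussianMoment_pos d
      positivity)
    filter_upwards [h] with ω hω
    simpa [sphereEval_eq_zero_iff] using hω
  have hcount : (fun ω => realEDCount (fun x => f x ω) ξ) =ᵐ[P]
      fun ω => (({x | (p ω).eval x = 0}.encard : ℕ∞) : ℝ≥0∞) := by
    filter_upwards [hfp, hp.ae_isGenericPoly hd, hξ] with ω hω hgen hωξ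
    rw [show (fun x => f x ω) = fun x => (p ω).eval x from funext hω]
    exact hgen.realEDCount_eq hωξ
  have h := hp.lintegral_encard_zeros hd
  exact ⟨h.1.congr hcount.symm, (lintegral_congr_ae hcount).trans h.2⟩

end
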